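/- A hive for $\mathrm{GL}(n)$ is a triangular array of integers $h=(h_{ij})_{1\le j\le i\le n+1}$ with $h_{11}=0$ that satisfies the rhombus conditions $$h_{i,j}+h_{i+1,j+1}\ge h_{i+1,j}+h_{i,j+1}\quad(1\le j<i\le n),$$ $$h_{i,j}+h_{i,j+1}\ge h_{i+1,j+1}+h_{i-1,j}\quad(1\le j<i\le n),$$ $$h_{i+1,j}+h_{i,j}\ge h_{i+1,j+1}+h_{i,j-1}\quad(1<j\le i\le n),$$ and whose boundary sequences $a_i=h_{i+1,i+1}-h_{i,i}$, $b_i=h_{i+1,1}-h_{i,1}$, $c_i=h_{n+1,i+1}-h_{n+1,i}$ ($1\le i\le n$) are weakly decreasing and non-negative. The hives form a submonoid $\mathcal H(n)$ of $\mathbb Z^{(n+1)(n+2)/2}$. The entries of a hive are non-negative, and the hive algebra $\mathrm{HA}(n)$ is the subalgebra of $\mathbb C[z_{ij}:1\le j\le i\le n+1]$ generated by the monomials $\mathbf z^h=\prod_{i,j}z_{ij}^{h_{ij}}$, $h\in\mathcal H(n)$. It is graded: its component of degree $d$ is spanned by the $\mathbf z^h$ with $a_1+\cdots+a_n=d$ (equivalently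 $h_{n+1,n+1}=d$). Its Hilbert–Poincaré series is $\mathfrak{HP}_n(t)=\sum_{d\ge0}m_d t^d$, where $m_d$ is the dimension of the component of degree $d$. The Hilbert basis of a monoid is its smallest generating set. **Theorem.** (0) The following twenty distinct arrays, written as $(h_{11},h_{21},h_{22},h_{31},\dots,h_{55})$, form the Hilbert basis of $\mathcal H(4)$: $$\begin{aligned} h_{1}&=(0,0,1,0,1,1,0,1,1,1,0,1,1,1,1)\\ h_{2}&=(0,0,1,0,1,2,0,1,2,2,0,1,2,2,2)\\ h_{3}&=(0,0,1,0,1,2,0,1,2,3,0,1,2,3,3)\\ h_{4}&=(0,0,1,0,1,2,0,1,2,3,0,1,2,3,4)\\ h_{5}&=(0,1,1,1,1,1,1,1,1,1,1,1,1,1,1)\\ h_{6}&=(0,1,1,1,2,2,1,2,2,2,1,2,2,2,2)\\ h_{7}&=(0,1,1,1,2,2,1,2,3,3,1,2,3,3,3)\\ h_{8}&=(0,1,1,1,2,2,1,2,3,3,1,2,3,4,4)\\ h_{9}&=(0,1,1,2,2,2,2,2,2,2,2,2,2,2,2)\\ h_{10}&=(0,1,1,2,2,2,2,3,3,3,2,3,3,3,3)\\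 h_{11}&=(0,1,1,2,2,2,2,3,3,3,2,3,4,4,4)\\ h_{12}&=(0,1,1,2,2,2,3,3,3,3,3,3,3,3,3)\\ h_{13}&=(0,1,1,2,2,2,3,3,3,3,3,4,4,4,4)\\ h_{14}&=(0,1,1,2,2,2,3,3,3,3,4,4,4,4,4)\\ h_{15}&=(0,1,2,2,3,3,2,3,4,4,2,3,4,4,4)\\ h_{16}&=(0,1,2,2,3,3,2,3,4,4,2,3,4,5,5)\\ h_{17}&=(0,1,2,2,3,4,2,4,5,5,2,4,5,6,6)\\ h_{18}&=(0,1,2,2,3,3,3,4,4,4,3,4,5,5,5)\\ h_{19}&=(0,1,2,2,3,4,3,4,5,5,3,4,5,6,6)\\ h_{20}&=(0,2,2,3,4,4,4,5,5,5,4,5,6,6,6). \end{aligned}$$ (1) There is an isomorphism of $\mathbb C$-algebras $\mathbb C[x_1,\dots,x_{20}]/I\cong\mathrm{HA}(4)$ that sends the class of $x_k$ to $\mathbf z^{h_k}$ for all $k$, where $I$ is the ideal generated by the fifteen binomials $$\begin{aligned} &x_1x_7x_9-x_6x_{15},\quad x_1x_8x_9-x_6x_{16},\quad x_1x_{11}x_{12}-x_{10}x_{18},\\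 &x_6x_{11}x_{12}-x_{10}x_{20},\quad x_2x_8x_{10}-x_7x_{17},\quad x_2x_8x_{12}-x_7x_{19},\\ &x_6x_{18}-x_1x_{20},\quad x_7x_{16}-x_8x_{15},\quad x_{10}x_{19}-x_{12}x_{17},\\ &x_{15}x_{17}-x_2x_{10}x_{16},\quad x_{15}x_{19}-x_2x_{12}x_{16},\quad x_{15}x_{20}-x_7x_9x_{18},\\ &x_{16}x_{20}-x_8x_9x_{18},\quad x_{17}x_{20}-x_6x_{11}x_{19},\quad x_{17}x_{18}-x_1x_{11}x_{19}. \end{aligned}$$ (2) All homogeneous components of $\mathrm{HA}(4)$ are finite-dimensional, and $\mathfrak{HP}_4(t)=f(t)/g(t)$ as formal power series, where $$\begin{aligned} f(t)={}&1-2t-2t^2+10t^3-2t^4-24t^5+22t^6+32t^7-54t^8-18t^9+80t^{10}\\ &-14t^{11}-72t^{12}+34t^{13}+44t^{14}-18t^{15}-25t^{16}-18t^{17}+44t^{18}+34t^{19}\\ &-72t^{20}-14t^{21}+80t^{22}-18t^{23}-54t^{24}+32t^{25}+22t^{26}-24t^{27}\\ &-2t^{28}+10t^{29}-2t^{30}-2t^{31}+t^{32},\\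 g(t)={}&(1-t)^4(1-t^2)^6(1-t^{12})^4 . \end{aligned}$$ The polynomial $f$ has degree $32$ and is palindromic, and $$\mathfrak{HP}_4(t)=1+2t+6t^2+14t^3+34t^4+68t^5+142t^6+268t^7+508t^8+902t^9+\cdots.$$ -/

import Mathlib

/-- The positions `(i, j)` with `1 ≤ j ≤ i ≤ n + 1` of a triangular array for `GL(n)`. -/
def triIndices (n : ℕ) : Finset (ℕ × ℕ) :=
  (Finset.Icc 1 (n + 1) ×ˢ Finset.Icc 1 (n + 1)).filter fun p => p.2 ≤ p.1

/-- The index type of the positions of a triangular array for `GL(n)`. -/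
abbrev TriIndex (n : ℕ) : Type := {p : ℕ × ℕ // p ∈ triIndices n}

/-- Triangular arrays of integers `(h i j)`, `1 ≤ j ≤ i ≤ n + 1`: the free abelian group
`ℤ ^ ((n + 1) (n + 2) / 2)`. -/
abbrev TriArray (n : ℕ) : Type := TriIndex n → ℤ

/-- The entry `h i j` of a triangular array, with the 1-based indices of the figure.  The value `0`
outside the range `1 ≤ j ≤ i ≤ n + 1` is never used below. -/
def TriArray.entry {n : ℕ} (h : TriArray n) (i j : ℕ) : ℤ :=
  if H : (i, j) ∈ triIndices n then h ⟨(i, j), H⟩ else 0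

/-- A sequence `κ = (κ₁, …, κₙ)` with `κ₁ ≥ κ₂ ≥ ⋯ ≥ κₙ ≥ 0`. -/
def IsNonnegDominant {n : ℕ} (κ : Fin n → ℤ) : Prop :=
  Antitone κ ∧ ∀ i, 0 ≤ κ i

/-- The right edge differences `a_i = h_{i+1,i+1} - h_{i,i}`, `1 ≤ i ≤ n`
(`k : Fin n` stands for `i = k + 1`). -/
def TriArray.boundaryA {n : ℕ} (h : TriArray n) : Fin n → ℤ :=
  fun k => h.entry (k + 2) (k + 2) - h.entry (k + 1) (k + 1)

/-- The left edge differences `b_i = h_{i+1,1} - h_{i,1}`, `1 ≤ i ≤ n`. -/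
def TriArray.boundaryB {n : ℕ} (h : TriArray n) : Fin n → ℤ :=
  fun k => h.entry (k + 2) 1 - h.entry (k + 1) 1

/-- The bottom edge differences `c_i = h_{n+1,i+1} - h_{n+1,i}`, `1 ≤ i ≤ n`. -/
def TriArray.boundaryC {n : ℕ} (h : TriArray n) : Fin n → ℤ :=
  fun k => h.entry (n + 1) (k + 2) - h.entry (n + 1) (k + 1)

/-- Hives for `GL(n)`. -/
structure IsHive {n : ℕ} (h : TriArray n) : Prop where
  top_eq_zero : h.entry 1 1 = 0
  rhombus₁ : ∀ i j : ℕ, 1 ≤ j → j < i → i ≤ n →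
    h.entry (i + 1) j + h.entry i (j + 1) ≤ h.entry i j + h.entry (i + 1) (j + 1)
  rhombus₂ : ∀ i j : ℕ, 1 ≤ j → j < i → i ≤ n →
    h.entry (i + 1) (j + 1) + h.entry (i - 1) j ≤ h.entry i j + h.entry i (j + 1)
  rhombus₃ : ∀ i j : ℕ, 1 < j → j ≤ i → i ≤ n →
    h.entry (i + 1) (j + 1) + h.entry i (j - 1) ≤ h.entry (i + 1) j + h.entry i j
  dominantA : IsNonnegDominant h.boundaryA
  dominantB : IsNonnegDominant h.boundaryB
  dominantC : IsNonnegDominant h.boundaryC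

theorem TriArray.entry_zero {n : ℕ} (i j : ℕ) : (0 : TriArray n).entry i j = 0 := by
  unfold TriArray.entry; split <;> rfl

theorem TriArray.entry_add {n : ℕ} (h h' : TriArray n) (i j : ℕ) :
    (h + h').entry i j = h.entry i j + h'.entry i j := by
  unfold TriArray.entry; split <;> simp

theorem IsNonnegDominant.zero {n : ℕ} : IsNonnegDominant (0 : Fin n → ℤ) :=
  ⟨fun _ _ _ => le_rfl, fun _ => le_rfl⟩

theorem IsNonnegDominant.add {n : ℕ} {κ κ' : Fin n → ℤ} (h : IsNonnegDominant κ)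
    (h' : IsNonnegDominant κ') : IsNonnegDominant (κ + κ') :=
  ⟨fun _ _ hij => add_le_add (h.1 hij) (h'.1 hij), fun i => add_nonneg (h.2 i) (h'.2 i)⟩

theorem IsHive.zero {n : ℕ} : IsHive (0 : TriArray n) where
  top_eq_zero := TriArray.entry_zero _ _
  rhombus₁ i j _ _ _ := by simp [TriArray.entry_zero]
  rhombus₂ i j _ _ _ := by simp [TriArray.entry_zero]
  rhombus₃ i j _ _ _ := by simp [TriArray.entry_zero]
  dominantA := by
    convert IsNonnegDominant.zero; funext k; simp [TriArray.boundaryA, TriArray.entry_zero]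
  dominantB := by
    convert IsNonnegDominant.zero; funext k; simp [TriArray.boundaryB, TriArray.entry_zero]
  dominantC := by
    convert IsNonnegDominant.zero; funext k; simp [TriArray.boundaryC, TriArray.entry_zero]

theorem IsHive.add {n : ℕ} {h h' : TriArray n} (H : IsHive h) (H' : IsHive h') :
    IsHive (h + h') where
  top_eq_zero := by rw [TriArray.entry_add, H.top_eq_zero, H'.top_eq_zero, add_zero]
  rhombus₁ i j h1 h2 h3 := by
    simp only [TriArray.entry_add]
    linarith [H.rhombus₁ i j h1 h2 h3, H'.rhombus₁ i j h1 h2 h3]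
  rhombus₂ i j h1 h2 h3 := by
    simp only [TriArray.entry_add]
    linarith [H.rhombus₂ i j h1 h2 h3, H'.rhombus₂ i j h1 h2 h3]
  rhombus₃ i j h1 h2 h3 := by
    simp only [TriArray.entry_add]
    linarith [H.rhombus₃ i j h1 h2 h3, H'.rhombus₃ i j h1 h2 h3]
  dominantA := by
    convert H.dominantA.add H'.dominantA; funext k
    simp only [TriArray.boundaryA, TriArray.entry_add, Pi.add_apply]; ring
  dominantB := by
    convert H.dominantB.add H'.dominantB; funext k
    simp only [TriArray.boundaryB, TriArray.entry_add, Pi.add_apply]; ring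
  dominantC := by
    convert H.dominantC.add H'.dominantC; funext k
    simp only [TriArray.boundaryC, TriArray.entry_add, Pi.add_apply]; ring

/-- The hive cone `𝓗(n)`: the submonoid of `ℤ ^ ((n + 1) (n + 2) / 2)` of all hives for `GL(n)`. -/
def hiveCone (n : ℕ) : AddSubmonoid (TriArray n) where
  carrier := {h | IsHive h}
  zero_mem' := IsHive.zero
  add_mem' := IsHive.add

/-- The entries of a hive are non-negative, so that `z ^ h` below is a monomial whose exponents
are exactly the entries of `h`. -/
theorem IsHive.nonneg {n : ℕ} {h : TriArray n} (H : IsHive h) (p : TriIndex n) : 0 ≤ h p := by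
  have left : ∀ i, i ≤ n → 0 ≤ h.entry (i + 1) 1 := by
    intro i
    induction i with
    | zero => intro _; exact H.top_eq_zero.ge
    | succ i ih =>
      intro hi
      have h1 := H.dominantB.2 ⟨i, by omega⟩
      have h2 := ih (by omega)
      simp only [TriArray.boundaryB] at h1
      have e : i + 1 + 1 = i + 2 := rfl
      rw [e]; linarith
  have diag : ∀ k i j, 1 ≤ j → j + k = i → i ≤ n → h.entry i j ≤ h.entry (i + 1) (j + 1) := by
    intro k
    induction k with
    | zero =>
      intro i j hj hk hi
      have h1 := H.dominantA.2 ⟨i - 1, by omega⟩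
      simp only [TriArray.boundaryA] at h1
      have e1 : i - 1 + 2 = i + 1 := by omega
      have e2 : i - 1 + 1 = i := by omega
      have e3 : j = i := by omega
      rw [e1, e2] at h1
      subst e3; linarith
    | succ k ih =>
      intro i j hj hk hi
      have h1 := ih i (j + 1) (by omega) (by omega) hi
      have h2 := H.rhombus₃ i (j + 1) (by omega) (by omega) hi
      simp only [Nat.add_sub_cancel] at h2
      linarith
  have all : ∀ j i, j < i → i ≤ n + 1 → 0 ≤ h.entry i (j + 1) := by
    intro j
    induction j with
    | zero =>
      intro i h1 h2
      obtain ⟨k, rfl⟩ : ∃ k, i = k + 1 := ⟨i - 1, by omega⟩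
      exact left k (by omega)
    | succ j ih =>
      intro i h1 h2
      obtain ⟨k, rfl⟩ : ∃ k, i = k + 1 := ⟨i - 1, by omega⟩
      exact (ih k (by omega) (by omega)).trans
        (diag (k - (j + 1)) k (j + 1) (by omega) (by omega) (by omega))
  obtain ⟨⟨i, j⟩, hp⟩ := p
  have hp' := hp
  simp only [triIndices, Finset.mem_filter, Finset.mem_product, Finset.mem_Icc] at hp'
  have := all (j - 1) i (by omega) (by omega)
  rw [show j - 1 + 1 = j by omega] at this
  simpa [TriArray.entry, hp] using this

/-- The monomial `z ^ h = ∏ z_{ij} ^ h_{ij}` in `ℂ[z_{ij}]` of an array with non-negative entries. -/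
noncomputable def zMonomial {n : ℕ} (h : TriArray n) : MvPolynomial (TriIndex n) ℂ :=
  ∏ p : TriIndex n, MvPolynomial.X p ^ (h p).toNat

/-- The hive algebra `HA(n)`: the subalgebra of `ℂ[z_{ij}]` generated by the `z ^ h`, `h` a hive. -/
noncomputable def hiveAlgebra (n : ℕ) : Subalgebra ℂ (MvPolynomial (TriIndex n) ℂ) :=
  Algebra.adjoin ℂ (zMonomial '' (hiveCone n : Set (TriArray n)))

/-- `HA(n)^λ_{μν}`: the subspace of `HA(n)` spanned by the monomials `z ^ h` of the
hives `h` with boundary `(lam, μ, ν)`. -/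
noncomputable def hiveAlgebraComponent (n : ℕ) (lam μ ν : Fin n → ℤ) :
    Submodule ℂ (hiveAlgebra n) :=
  Submodule.span ℂ {f | ∃ h ∈ hiveCone n,
    h.boundaryA = lam ∧ h.boundaryB = μ ∧ h.boundaryC = ν ∧
      (f : MvPolynomial (TriIndex n) ℂ) = zMonomial h}

/-- The homogeneous component of degree `d` of `HA(n)`: the sum of the `HA(n)^λ_{μν}` over the
triples of non-negative dominant sequences with `|λ| = d`. -/
noncomputable def hiveAlgebraDegree (n d : ℕ) : Submodule ℂ (hiveAlgebra n) :=
  ⨆ (lam : Fin n → ℤ) (μ : Fin n → ℤ) (ν : Fin n → ℤ)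
    (_ : IsNonnegDominant lam ∧ IsNonnegDominant μ ∧ IsNonnegDominant ν ∧ ∑ i, lam i = d),
    hiveAlgebraComponent n lam μ ν

/-- The Hilbert–Poincaré series `∑ m_d t ^ d` of `HA(n)`, where `m_d` is the dimension of the
homogeneous component of degree `d`. -/
noncomputable def hiveSeries (n : ℕ) : PowerSeries ℤ :=
  PowerSeries.mk fun d => (Module.finrank ℂ (hiveAlgebraDegree n d) : ℤ)

/-- `B` is the Hilbert basis of the monoid `M`: the smallest set that generates `M`. -/
def IsHilbertBasis {A : Type*} [AddMonoid A] (M : AddSubmonoid A) (B : Set A) : Prop :=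
  IsLeast {S : Set A | AddSubmonoid.closure S = M} B

/-- The triangular array for `GL(4)` with the listed entries, read in the order
`h₁₁, h₂₁, h₂₂, h₃₁, …, h₅₅`. -/
def triArrayOfList (l : List ℤ) : TriArray 4 :=
  fun p => l.getD (p.1.1 * (p.1.1 - 1) / 2 + (p.1.2 - 1)) 0

/-- Twenty hives `h₁, …, h₂₀` for `GL(4)`; `h_k` is the value at `k - 1 : Fin 20`. -/
def basisHive : Fin 20 → TriArray 4 := fun k => triArrayOfList (![
  [0, 0, 1, 0, 1, 1, 0, 1, 1, 1, 0, 1, 1, 1, 1],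
  [0, 0, 1, 0, 1, 2, 0, 1, 2, 2, 0, 1, 2, 2, 2],
  [0, 0, 1, 0, 1, 2, 0, 1, 2, 3, 0, 1, 2, 3, 3],
  [0, 0, 1, 0, 1, 2, 0, 1, 2, 3, 0, 1, 2, 3, 4],
  [0, 1, 1, 1, 1, 1, 1, 1, 1, 1, 1, 1, 1, 1, 1],
  [0, 1, 1, 1, 2, 2, 1, 2, 2, 2, 1, 2, 2, 2, 2],
  [0, 1, 1, 1, 2, 2, 1, 2, 3, 3, 1, 2, 3, 3, 3],
  [0, 1, 1, 1, 2, 2, 1, 2, 3, 3, 1, 2, 3, 4, 4],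
  [0, 1, 1, 2, 2, 2, 2, 2, 2, 2, 2, 2, 2, 2, 2],
  [0, 1, 1, 2, 2, 2, 2, 3, 3, 3, 2, 3, 3, 3, 3],
  [0, 1, 1, 2, 2, 2, 2, 3, 3, 3, 2, 3, 4, 4, 4],
  [0, 1, 1, 2, 2, 2, 3, 3, 3, 3, 3, 3, 3, 3, 3],
  [0, 1, 1, 2, 2, 2, 3, 3, 3, 3, 3, 4, 4, 4, 4],
  [0, 1, 1, 2, 2, 2, 3, 3, 3, 3, 4, 4, 4, 4, 4],
  [0, 1, 2, 2, 3, 3, 2, 3, 4, 4, 2, 3, 4, 4, 4],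
  [0, 1, 2, 2, 3, 3, 2, 3, 4, 4, 2, 3, 4, 5, 5],
  [0, 1, 2, 2, 3, 4, 2, 4, 5, 5, 2, 4, 5, 6, 6],
  [0, 1, 2, 2, 3, 3, 3, 4, 4, 4, 3, 4, 5, 5, 5],
  [0, 1, 2, 2, 3, 4, 3, 4, 5, 5, 3, 4, 5, 6, 6],
  [0, 2, 2, 3, 4, 4, 4, 5, 5, 5, 4, 5, 6, 6, 6]] k)

/-- The indeterminates `x₁, …, x₂₀` of `ℂ[x₁, …, x₂₀]`, with 1-based numbering:
`xVar k` is `X (k - 1)` for `1 ≤ k ≤ 20`. -/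
noncomputable def xVar (k : ℕ) : MvPolynomial (Fin 20) ℂ :=
  MvPolynomial.X (Fin.ofNat 20 (k - 1))

/-- The fifteen binomials `r₁, …, r₁₅`. -/
noncomputable def hiveRelations : Fin 15 → MvPolynomial (Fin 20) ℂ := ![
  xVar 1 * xVar 7 * xVar 9 - xVar 6 * xVar 15,
  xVar 1 * xVar 8 * xVar 9 - xVar 6 * xVar 16,
  xVar 1 * xVar 11 * xVar 12 - xVar 10 * xVar 18,
  xVar 6 * xVar 11 * xVar 12 - xVar 10 * xVar 20,
  xVar 2 * xVar 8 * xVar 10 - xVar 7 * xVar 17,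
  xVar 2 * xVar 8 * xVar 12 - xVar 7 * xVar 19,
  xVar 6 * xVar 18 - xVar 1 * xVar 20,
  xVar 7 * xVar 16 - xVar 8 * xVar 15,
  xVar 10 * xVar 19 - xVar 12 * xVar 17,
  xVar 15 * xVar 17 - xVar 2 * xVar 10 * xVar 16,
  xVar 15 * xVar 19 - xVar 2 * xVar 12 * xVar 16,
  xVar 15 * xVar 20 - xVar 7 * xVar 9 * xVar 18,
  xVar 16 * xVar 20 - xVar 8 * xVar 9 * xVar 18,
  xVar 17 * xVar 20 - xVar 6 * xVar 11 * xVar 19,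
  xVar 17 * xVar 18 - xVar 1 * xVar 11 * xVar 19]

/-- The ideal generated by the fifteen binomials. -/
noncomputable def hiveIdeal : Ideal (MvPolynomial (Fin 20) ℂ) :=
  Ideal.span (Set.range hiveRelations)

section
open Polynomial

/-- The numerator `f(t)`. -/
noncomputable def hiveNumerator : ℤ[X] :=
  1 - 2 * X - 2 * X ^ 2 + 10 * X ^ 3 - 2 * X ^ 4 - 24 * X ^ 5 + 22 * X ^ 6 + 32 * X ^ 7
    - 54 * X ^ 8 - 18 * X ^ 9 + 80 * X ^ 10 - 14 * X ^ 11 - 72 * X ^ 12 + 34 * X ^ 13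
    + 44 * X ^ 14 - 18 * X ^ 15 - 25 * X ^ 16 - 18 * X ^ 17 + 44 * X ^ 18 + 34 * X ^ 19
    - 72 * X ^ 20 - 14 * X ^ 21 + 80 * X ^ 22 - 18 * X ^ 23 - 54 * X ^ 24 + 32 * X ^ 25
    + 22 * X ^ 26 - 24 * X ^ 27 - 2 * X ^ 28 + 10 * X ^ 29 - 2 * X ^ 30 - 2 * X ^ 31 + X ^ 32

/-- The denominator `g(t)`; its constant coefficient is `1`, so it is invertible in `ℤ⟦t⟧`. -/
noncomputable def hiveDenominator : ℤ[X] :=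
  (1 - X) ^ 4 * (1 - X ^ 2) ^ 6 * (1 - X ^ 12) ^ 4

end

/-! Send an exponent vector e in ℕ^20 to ∑ e_k h_k (`hiveSum`). In each binomial a squarefree
quadratic term is chosen as leading, and e is standard if no leading term divides x^e. Everything
rests on one fact: `hiveSum` is a bijection from standard vectors to hives, with explicit inverse
`normalForm`. Arrays with h₁₁ = 0 have fourteen integral coordinates, so twenty exponents leave six
free parameters; the inverse fixes these as six minima of linear forms. The resulting exponents are
non-negative by the inequalities of the cone, and the fifteen leading terms are precisely the
complementarity conditions under which the minima return the original exponents
(`hiveSum_normalForm`, `normalForm_hiveSum`).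

Replacing a leading term by its tail lowers a weight, so every monomial is congruent modulo I to a
standard one (`exists_standard`), which by the bijection depends only on the image hive. Hence I is
the whole kernel of x_k ↦ z^{h_k}, and no S-pairs are needed. Moreover a rewritten monomial keeps
degree at least 2, so x_k is the only monomial over h_k. Thus the h_k are irreducible, and as they
generate, they form the Hilbert basis.

The z^h are linearly independent, so m_d is the number of standard monomials of degree d. Their
supports are the faces of a simplicial complex (up to variables in no leading term), which is
partitioned into fourteen intervals. Each interval contributes a product of geometric series, and
the sum of these products is f/g. -/

/-! ### The hive cone of GL(4) by twenty inequalities -/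

/-- Evaluation of an entry, as an additive homomorphism. -/
def TriArray.entryHom {n : ℕ} (i j : ℕ) : TriArray n →+ ℤ where
  toFun h := h.entry i j
  map_zero' := TriArray.entry_zero i j
  map_add' h h' := TriArray.entry_add h h' i j

theorem TriArray.ext_four {h h' : TriArray 4}
    (h11 : h.entry 1 1 = h'.entry 1 1) (h21 : h.entry 2 1 = h'.entry 2 1)
    (h22 : h.entry 2 2 = h'.entry 2 2) (h31 : h.entry 3 1 = h'.entry 3 1)
    (h32 : h.entry 3 2 = h'.entry 3 2) (h33 : h.entry 3 3 = h'.entry 3 3)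
    (h41 : h.entry 4 1 = h'.entry 4 1) (h42 : h.entry 4 2 = h'.entry 4 2)
    (h43 : h.entry 4 3 = h'.entry 4 3) (h44 : h.entry 4 4 = h'.entry 4 4)
    (h51 : h.entry 5 1 = h'.entry 5 1) (h52 : h.entry 5 2 = h'.entry 5 2)
    (h53 : h.entry 5 3 = h'.entry 5 3) (h54 : h.entry 5 4 = h'.entry 5 4)
    (h55 : h.entry 5 5 = h'.entry 5 5) : h = h' := by
  funext ⟨⟨i, j⟩, hp⟩
  suffices h.entry i j = h'.entry i j by simpa [TriArray.entry, hp] using this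
  have hp' := hp
  simp only [triIndices, Finset.mem_filter, Finset.mem_product, Finset.mem_Icc] at hp'
  obtain ⟨⟨⟨hi, hi'⟩, hj, -⟩, hij⟩ := hp'
  interval_cases i <;> interval_cases j <;> assumption

/-- The integral points of the hive cone for `GL(4)` are cut out by these inequalities. -/
structure IsHiveFour (h11 h21 h22 h31 h32 h33 h41 h42 h43 h44 h51 h52 h53 h54 h55 : ℤ) : Prop where
  top : h11 = 0
  n3 : h43 + h55 ≤ h44 + h54
  n4 : h54 ≤ h55
  n5 : h32 ≤ h21 + h22
  n13 : h42 + h51 ≤ h41 + h52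
  n14 : h41 ≤ h51
  al : h42 + h54 ≤ h43 + h53
  v : h32 + h44 ≤ h33 + h43
  ga : h22 + h43 ≤ h32 + h33
  q : h21 + h42 ≤ h31 + h32
  b : h43 + h52 ≤ h42 + h53
  ep : h32 + h41 ≤ h31 + h42
  alBe : h33 + h42 ≤ h32 + h43
  gaDe : h31 + h43 ≤ h32 + h42
  uv : h32 + h53 ≤ h42 + h43
  alU : h33 + h54 ≤ h43 + h44
  vBe : h44 + h53 ≤ h43 + h54
  gaP : h22 + h31 ≤ h21 + h32
  qDe : h21 + h33 ≤ h22 + h32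
  bZe : h31 + h52 ≤ h41 + h42
  epA : h41 + h53 ≤ h42 + h52

/-- The eighteen rhombi together with b₄ ≥ 0 and c₄ ≥ 0 suffice. Pairs of rhombi along an edge add
up to the decrease of its boundary sequence, and rhombi in the bottom strip give h₅₄ - h₄₄ ≥ b₄,
hence a₄ ≥ b₄ + c₄. -/
theorem isHive_four_iff (h : TriArray 4) : IsHive h ↔
    IsHiveFour (h.entry 1 1) (h.entry 2 1) (h.entry 2 2) (h.entry 3 1) (h.entry 3 2) (h.entry 3 3)
      (h.entry 4 1) (h.entry 4 2) (h.entry 4 3) (h.entry 4 4) (h.entry 5 1) (h.entry 5 2)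
      (h.entry 5 3) (h.entry 5 4) (h.entry 5 5) := by
  constructor
  · intro H
    have A1 := H.rhombus₁ 2 1 (by norm_num) (by norm_num) (by norm_num)
    have A2 := H.rhombus₁ 3 1 (by norm_num) (by norm_num) (by norm_num)
    have A3 := H.rhombus₁ 3 2 (by norm_num) (by norm_num) (by norm_num)
    have A4 := H.rhombus₁ 4 1 (by norm_num) (by norm_num) (by norm_num)
    have A5 := H.rhombus₁ 4 2 (by norm_num) (by norm_num) (by norm_num)
    have A6 := H.rhombus₁ 4 3 (by norm_num) (by norm_num) (by norm_num)
    have B1 := H.rhombus₂ 2 1 (by norm_num) (by norm_num) (by norm_num)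
    have B2 := H.rhombus₂ 3 1 (by norm_num) (by norm_num) (by norm_num)
    have B3 := H.rhombus₂ 3 2 (by norm_num) (by norm_num) (by norm_num)
    have B4 := H.rhombus₂ 4 1 (by norm_num) (by norm_num) (by norm_num)
    have B5 := H.rhombus₂ 4 2 (by norm_num) (by norm_num) (by norm_num)
    have B6 := H.rhombus₂ 4 3 (by norm_num) (by norm_num) (by norm_num)
    have C1 := H.rhombus₃ 2 2 (by norm_num) (by norm_num) (by norm_num)
    have C2 := H.rhombus₃ 3 2 (by norm_num) (by norm_num) (by norm_num)
    have C3 := H.rhombus₃ 3 3 (by norm_num) (by norm_num) (by norm_num)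
    have C4 := H.rhombus₃ 4 2 (by norm_num) (by norm_num) (by norm_num)
    have C5 := H.rhombus₃ 4 3 (by norm_num) (by norm_num) (by norm_num)
    have C6 := H.rhombus₃ 4 4 (by norm_num) (by norm_num) (by norm_num)
    have D1 := H.dominantB.2 3
    have D2 := H.dominantC.2 3
    have D3 := H.top_eq_zero
    simp only [TriArray.boundaryB, TriArray.boundaryC, Nat.reduceAdd, Nat.reduceSub, Fin.isValue,
      Nat.reduceMod, Fin.coe_ofNat_eq_mod] at *
    constructor <;> omega
  · intro H
    obtain ⟨_, _, _, _, _, _, _, _, _, _, _, _, _, _, _, _, _, _, _, _, _⟩ := H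
    refine ⟨by assumption, ?_, ?_, ?_, ⟨?_, ?_⟩, ⟨?_, ?_⟩, ⟨?_, ?_⟩⟩
    · intro i j h1 h2 h3
      interval_cases i <;> interval_cases j <;> simp only [Nat.reduceAdd] <;> omega
    · intro i j h1 h2 h3
      interval_cases i <;> interval_cases j <;> simp only [Nat.reduceAdd, Nat.reduceSub] <;> omega
    · intro i j h1 h2 h3
      interval_cases i <;> interval_cases j <;> simp only [Nat.reduceAdd, Nat.reduceSub] <;> omega
    · rw [Fin.antitone_iff_succ_le]
      intro i; fin_cases i <;> simp [TriArray.boundaryA] <;> omega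
    · intro i; fin_cases i <;> simp [TriArray.boundaryA] <;> omega
    · rw [Fin.antitone_iff_succ_le]
      intro i; fin_cases i <;> simp [TriArray.boundaryB] <;> omega
    · intro i; fin_cases i <;> simp [TriArray.boundaryB] <;> omega
    · rw [Fin.antitone_iff_succ_le]
      intro i; fin_cases i <;> simp [TriArray.boundaryC] <;> omega
    · intro i; fin_cases i <;> simp [TriArray.boundaryC] <;> omega

/-! ### Standard monomials and the normal form of a hive -/

/-- The array `∑ e_k h_k`. -/
def hiveSum : (Fin 20 →₀ ℕ) →+ TriArray 4 where
  toFun e := ∑ k, e k • basisHive k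
  map_zero' := by simp
  map_add' e f := by simp [add_smul, Finset.sum_add_distrib]

theorem hiveSum_entry (e : Fin 20 →₀ ℕ) (i j : ℕ) :
    (hiveSum e).entry i j = ∑ k, (e k : ℤ) * (basisHive k).entry i j := by
  change TriArray.entryHom i j (∑ k, e k • basisHive k) = _
  rw [map_sum]
  refine Finset.sum_congr rfl fun k _ => ?_
  rw [map_nsmul, nsmul_eq_mul]
  rfl

theorem hiveSum_entries (e : Fin 20 →₀ ℕ) :
        (hiveSum e).entry 1 1 = 0 ∧
        (hiveSum e).entry 2 1 = e 4 + e 5 + e 6 + e 7 + e 8 + e 9 + e 10 + e 11 + e 12 + e 13 +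
      e 14 + e 15 + e 16 + e 17 + e 18 + 2 * e 19 ∧
        (hiveSum e).entry 2 2 = e 0 + e 1 + e 2 + e 3 + e 4 + e 5 + e 6 + e 7 + e 8 + e 9 + e 10
      + e 11 + e 12 + e 13 + 2 * e 14 + 2 * e 15 + 2 * e 16 + 2 * e 17 + 2 * e 18 + 2 * e 19 ∧
        (hiveSum e).entry 3 1 = e 4 + e 5 + e 6 + e 7 + 2 * e 8 + 2 * e 9 + 2 * e 10 + 2 * e 11
      + 2 * e 12 + 2 * e 13 + 2 * e 14 + 2 * e 15 + 2 * e 16 + 2 * e 17 + 2 * e 18 + 3 * e 19 ∧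
        (hiveSum e).entry 3 2 = e 0 + e 1 + e 2 + e 3 + e 4 + 2 * e 5 + 2 * e 6 + 2 * e 7 + 2 *
      e 8 + 2 * e 9 + 2 * e 10 + 2 * e 11 + 2 * e 12 + 2 * e 13 + 3 * e 14 + 3 * e 15 + 3 * e 16
      + 3 * e 17 + 3 * e 18 + 4 * e 19 ∧
        (hiveSum e).entry 3 3 = e 0 + 2 * e 1 + 2 * e 2 + 2 * e 3 + e 4 + 2 * e 5 + 2 * e 6 + 2
      * e 7 + 2 * e 8 + 2 * e 9 + 2 * e 10 + 2 * e 11 + 2 * e 12 + 2 * e 13 + 3 * e 14 + 3 * e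
      15 + 4 * e 16 + 3 * e 17 + 4 * e 18 + 4 * e 19 ∧
        (hiveSum e).entry 4 1 = e 4 + e 5 + e 6 + e 7 + 2 * e 8 + 2 * e 9 + 2 * e 10 + 3 * e 11
      + 3 * e 12 + 3 * e 13 + 2 * e 14 + 2 * e 15 + 2 * e 16 + 3 * e 17 + 3 * e 18 + 4 * e 19 ∧
        (hiveSum e).entry 4 2 = e 0 + e 1 + e 2 + e 3 + e 4 + 2 * e 5 + 2 * e 6 + 2 * e 7 + 2 *
      e 8 + 3 * e 9 + 3 * e 10 + 3 * e 11 + 3 * e 12 + 3 * e 13 + 3 * e 14 + 3 * e 15 + 4 * e 16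
      + 4 * e 17 + 4 * e 18 + 5 * e 19 ∧
        (hiveSum e).entry 4 3 = e 0 + 2 * e 1 + 2 * e 2 + 2 * e 3 + e 4 + 2 * e 5 + 3 * e 6 + 3
      * e 7 + 2 * e 8 + 3 * e 9 + 3 * e 10 + 3 * e 11 + 3 * e 12 + 3 * e 13 + 4 * e 14 + 4 * e
      15 + 5 * e 16 + 4 * e 17 + 5 * e 18 + 5 * e 19 ∧
        (hiveSum e).entry 4 4 = e 0 + 2 * e 1 + 3 * e 2 + 3 * e 3 + e 4 + 2 * e 5 + 3 * e 6 + 3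
      * e 7 + 2 * e 8 + 3 * e 9 + 3 * e 10 + 3 * e 11 + 3 * e 12 + 3 * e 13 + 4 * e 14 + 4 * e
      15 + 5 * e 16 + 4 * e 17 + 5 * e 18 + 5 * e 19 ∧
        (hiveSum e).entry 5 1 = e 4 + e 5 + e 6 + e 7 + 2 * e 8 + 2 * e 9 + 2 * e 10 + 3 * e 11
      + 3 * e 12 + 4 * e 13 + 2 * e 14 + 2 * e 15 + 2 * e 16 + 3 * e 17 + 3 * e 18 + 4 * e 19 ∧
        (hiveSum e).entry 5 2 = e 0 + e 1 + e 2 + e 3 + e 4 + 2 * e 5 + 2 * e 6 + 2 * e 7 + 2 *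
      e 8 + 3 * e 9 + 3 * e 10 + 3 * e 11 + 4 * e 12 + 4 * e 13 + 3 * e 14 + 3 * e 15 + 4 * e 16
      + 4 * e 17 + 4 * e 18 + 5 * e 19 ∧
        (hiveSum e).entry 5 3 = e 0 + 2 * e 1 + 2 * e 2 + 2 * e 3 + e 4 + 2 * e 5 + 3 * e 6 + 3
      * e 7 + 2 * e 8 + 3 * e 9 + 4 * e 10 + 3 * e 11 + 4 * e 12 + 4 * e 13 + 4 * e 14 + 4 * e
      15 + 5 * e 16 + 5 * e 17 + 5 * e 18 + 6 * e 19 ∧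
        (hiveSum e).entry 5 4 = e 0 + 2 * e 1 + 3 * e 2 + 3 * e 3 + e 4 + 2 * e 5 + 3 * e 6 + 4
      * e 7 + 2 * e 8 + 3 * e 9 + 4 * e 10 + 3 * e 11 + 4 * e 12 + 4 * e 13 + 4 * e 14 + 5 * e
      15 + 6 * e 16 + 5 * e 17 + 6 * e 18 + 6 * e 19 ∧
        (hiveSum e).entry 5 5 = e 0 + 2 * e 1 + 3 * e 2 + 4 * e 3 + e 4 + 2 * e 5 + 3 * e 6 + 4
      * e 7 + 2 * e 8 + 3 * e 9 + 4 * e 10 + 3 * e 11 + 4 * e 12 + 4 * e 13 + 4 * e 14 + 5 * e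
      15 + 6 * e 16 + 5 * e 17 + 6 * e 18 + 6 * e 19 := by
  simp only [hiveSum_entry, Fin.sum_univ_succ]
  simp [basisHive, triArrayOfList, TriArray.entry, triIndices]
  refine ⟨?_, ?_, ?_, ?_, ?_, ?_, ?_, ?_, ?_, ?_, ?_, ?_, ?_, ?_⟩ <;> ring

/-- The exponents of the standard monomial of a hive in terms of the values of fourteen linear
forms, which are coordinates on the lattice of triangular arrays for `GL(4)`. -/
def standardExponents (n3 n4 n5 n13 n14 al v ga q b ep p a u : ℤ) : Fin 20 → ℤ :=
  let x2 := min al v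
  let x9 := min ga q
  let x11 := min b ep
  let x15 := min (q - x9) (al - x2)
  let x20 := min (b - x11) (ga - x9)
  let x17 := min (v - x2) (ep - x11)
  ![a + x11 - (ga - x9 - x20), x2, n3, n4, n5, ga - x9 - x20, al - x2 - x15,
    p + x9 - (al - x2 - x15), x9, ep - x11 - x17, x11, u + x2 - (ep - x11 - x17), n13, n14, x15,
    q - x9 - x15, x17, b - x11 - x20, v - x2 - x17, x20]

/-- The hypotheses are the twenty inequalities of `IsHiveFour` in the new coordinates. The field
names there use be = p + q - al, de = a + b - ga and ze = u + v - ep. -/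
theorem standardExponents_nonneg {n3 n4 n5 n13 n14 al v ga q b ep p a u : ℤ}
    (h3 : 0 ≤ n3) (h4 : 0 ≤ n4) (h5 : 0 ≤ n5) (h13 : 0 ≤ n13) (h14 : 0 ≤ n14)
    (h1 : 0 ≤ al) (h2 : 0 ≤ v) (h6 : 0 ≤ ga) (h7 : 0 ≤ q) (h8 : 0 ≤ b) (h9 : 0 ≤ ep)
    (h10 : 0 ≤ p + q) (h11 : 0 ≤ a + b) (h12 : 0 ≤ u + v) (h15 : 0 ≤ al + u)
    (h16 : al ≤ v + p + q) (h17 : 0 ≤ ga + p) (h18 : ga ≤ q + a + b) (h19 : ep ≤ b + u + v)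
    (h20 : 0 ≤ ep + a) (k : Fin 20) :
    0 ≤ standardExponents n3 n4 n5 n13 n14 al v ga q b ep p a u k := by
  fin_cases k <;> simp only [standardExponents, Fin.reduceFinMk, Fin.zero_eta, Fin.mk_one,
    Matrix.cons_val] <;> omega

/-- The coordinates of a triangular array, turned into exponents. -/
def TriArray.exponents (h : TriArray 4) : Fin 20 → ℤ :=
  standardExponents (h.entry 4 4 - h.entry 4 3 + h.entry 5 4 - h.entry 5 5)
    (h.entry 5 5 - h.entry 5 4) (h.entry 2 1 + h.entry 2 2 - h.entry 3 2)
    (h.entry 4 1 - h.entry 4 2 - h.entry 5 1 + h.entry 5 2) (h.entry 5 1 - h.entry 4 1)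
    (h.entry 4 3 + h.entry 5 3 - h.entry 4 2 - h.entry 5 4)
    (h.entry 3 3 + h.entry 4 3 - h.entry 3 2 - h.entry 4 4)
    (h.entry 3 2 + h.entry 3 3 - h.entry 2 2 - h.entry 4 3)
    (h.entry 3 1 + h.entry 3 2 - h.entry 2 1 - h.entry 4 2)
    (h.entry 4 2 + h.entry 5 3 - h.entry 4 3 - h.entry 5 2)
    (h.entry 3 1 + h.entry 4 2 - h.entry 3 2 - h.entry 4 1)
    (h.entry 2 1 - h.entry 3 1 - h.entry 3 3 + h.entry 4 3)
    (h.entry 3 2 - h.entry 3 1 + h.entry 5 2 - h.entry 5 3)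
    (h.entry 4 2 - h.entry 3 3 + h.entry 4 4 - h.entry 5 3)

/-- The exponent vector of the standard monomial attached to a hive. -/
noncomputable def normalForm (h : TriArray 4) : Fin 20 →₀ ℕ :=
  Finsupp.equivFunOnFinite.symm fun k => (h.exponents k).toNat

theorem IsHive.exponents_nonneg {h : TriArray 4} (H : IsHive h) (k : Fin 20) :
    0 ≤ h.exponents k := by
  rw [isHive_four_iff] at H
  obtain ⟨_, _, _, _, _, _, _, _, _, _, _, _, _, _, _, _, _, _, _, _, _⟩ := H
  apply standardExponents_nonneg <;> omega

theorem IsHive.normalForm_apply {h : TriArray 4} (H : IsHive h) (k : Fin 20) :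
    (normalForm h k : ℤ) = h.exponents k :=
  Int.toNat_of_nonneg (H.exponents_nonneg k)

/-- The six minima cancel from every entry, so each identity is linear with the minima as atoms. The
hive conditions enter only through h₁₁ = 0 and the non-negativity that makes `toNat` harmless. -/
theorem hiveSum_normalForm {h : TriArray 4} (H : IsHive h) : hiveSum (normalForm h) = h := by
  have h11 := H.top_eq_zero
  obtain ⟨e11, e21, e22, e31, e32, e33, e41, e42, e43, e44, e51, e52, e53, e54, e55⟩ :=
    hiveSum_entries (normalForm h)
  simp only [H.normalForm_apply] at *
  simp only [TriArray.exponents, standardExponents, Matrix.cons_val] at *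
  apply TriArray.ext_four
  · rw [e11, h11]
  · rw [e21]; ring
  · rw [e22]; ring
  · rw [e31]; ring
  · rw [e32]; ring
  · rw [e33]; ring
  · rw [e41]; ring
  · rw [e42]; ring
  · rw [e43]; ring
  · rw [e44]; ring
  · rw [e51]; ring
  · rw [e52]; ring
  · rw [e53]; ring
  · rw [e54]; ring
  · rw [e55]; ring

/-- The indices of the variables in the leading monomials of the fifteen binomials. -/
def leadingPair : Fin 15 → Fin 20 × Fin 20 :=
  ![(5, 14), (5, 15), (9, 17), (9, 19), (6, 16), (6, 18), (5, 17), (6, 15), (9, 18),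
    (14, 16), (14, 18), (14, 19), (15, 19), (16, 19), (16, 17)]

/-- No leading monomial of the fifteen binomials divides the monomial with exponents `e`. -/
def IsStandard (e : Fin 20 → ℕ) : Prop :=
  ∀ i, e (leadingPair i).1 = 0 ∨ e (leadingPair i).2 = 0

theorem isStandard_iff (e : Fin 20 → ℕ) : IsStandard e ↔
    ((e 5 = 0 ∨ e 14 = 0) ∧ (e 5 = 0 ∨ e 15 = 0) ∧ (e 9 = 0 ∨ e 17 = 0) ∧ (e 9 = 0 ∨ e 19 = 0) ∧
    (e 6 = 0 ∨ e 16 = 0) ∧ (e 6 = 0 ∨ e 18 = 0) ∧ (e 5 = 0 ∨ e 17 = 0) ∧ (e 6 = 0 ∨ e 15 = 0) ∧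
    (e 9 = 0 ∨ e 18 = 0) ∧ (e 14 = 0 ∨ e 16 = 0) ∧ (e 14 = 0 ∨ e 18 = 0) ∧
    (e 14 = 0 ∨ e 19 = 0) ∧ (e 15 = 0 ∨ e 19 = 0) ∧ (e 16 = 0 ∨ e 19 = 0) ∧
    (e 16 = 0 ∨ e 17 = 0)) := by
  simp [IsStandard, Fin.forall_fin_succ, leadingPair]

theorem min_add_add_eq {a b c d x : ℕ} (hac : a = 0 ∨ c = 0) (had : a = 0 ∨ d = 0)
    (hbc : b = 0 ∨ c = 0) (hbd : b = 0 ∨ d = 0) : min (a + b + x : ℤ) (c + d + x) = x := by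
  omega

theorem min_add_sub_eq {a b x y z : ℕ} (h : a = 0 ∨ b = 0) :
    min (x + a + y - y : ℤ) (b + x + z - z) = x := by
  omega

/-- The two forms in each minimum share the exponent to be recovered, and standardness makes one of
the two remainders vanish. The minima for x₂, x₉, x₁₁ use four leading pairs each, those for x₁₅,
x₂₀, x₁₇ one each: 3·4 + 3 = 15. -/
theorem normalForm_hiveSum {e : Fin 20 →₀ ℕ} (he : IsStandard e) :
    normalForm (hiveSum e) = e := by
  obtain ⟨e11, e21, e22, e31, e32, e33, e41, e42, e43, e44, e51, e52, e53, e54, e55⟩ :=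
    hiveSum_entries e
  suffices H : ∀ k, (hiveSum e).exponents k = e k by
    ext k; simp [normalForm, H]
  have key : (hiveSum e).exponents =
    standardExponents (e 2) (e 3) (e 4) (e 12) (e 13) (e 6 + e 14 + e 1) (e 16 + e 18 + e 1)
      (e 5 + e 19 + e 8) (e 14 + e 15 + e 8) (e 19 + e 17 + e 10) (e 9 + e 16 + e 10)
      (e 6 + e 7 - e 8) (e 5 + e 0 - e 10) (e 9 + e 11 - e 1) := by
    unfold TriArray.exponents
    simp only [e21, e22, e31, e32, e33, e41, e42, e43, e44, e51, e52, e53, e54, e55]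
    clear e11 e21 e22 e31 e32 e33 e41 e42 e43 e44 e51 e52 e53 e54 e55
    -- With the function opaque, only its fourteen linear arguments are compared.
    generalize standardExponents = s
    congr 1 <;> ring
  rw [isStandard_iff] at he
  obtain ⟨c1, c2, c3, c4, c5, c6, c7, c8, c9, c10, c11, c12, c13, c14, c15⟩ := he
  have x2 : min (e 6 + e 14 + e 1 : ℤ) (e 16 + e 18 + e 1) = e 1 :=
    min_add_add_eq c5 c6 c10 c11
  have x9 : min (e 5 + e 19 + e 8 : ℤ) (e 14 + e 15 + e 8) = e 8 :=
    min_add_add_eq c1 c2 c12.symm c13.symm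
  have x11 : min (e 19 + e 17 + e 10 : ℤ) (e 9 + e 16 + e 10) = e 10 :=
    min_add_add_eq c4.symm c14.symm c3.symm c15.symm
  have x15 : min (e 14 + e 15 + e 8 - e 8 : ℤ) (e 6 + e 14 + e 1 - e 1) = e 14 :=
    min_add_sub_eq c8.symm
  have x20 : min (e 19 + e 17 + e 10 - e 10 : ℤ) (e 5 + e 19 + e 8 - e 8) = e 19 :=
    min_add_sub_eq c7.symm
  have x17 : min (e 16 + e 18 + e 1 - e 1 : ℤ) (e 9 + e 16 + e 10 - e 10) = e 16 :=
    min_add_sub_eq c9.symm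
  simp only [key, standardExponents, x2, x9, x11, x15, x20, x17]
  simp only [Fin.forall_fin_succ]
  simp

/-! ### Rewriting modulo the fifteen binomials -/

theorem leadingPair_ne : ∀ i, (leadingPair i).1 ≠ (leadingPair i).2 := by
  decide

/-- The indices of the variables in the non-leading monomials of the fifteen binomials. -/
def tailList : Fin 15 → List (Fin 20) :=
  ![[0, 6, 8], [0, 7, 8], [0, 10, 11], [5, 10, 11], [1, 7, 9], [1, 7, 11], [0, 19], [7, 14],
    [11, 16], [1, 9, 15], [1, 11, 15], [6, 8, 17], [7, 8, 17], [5, 10, 18], [0, 10, 18]]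

/-- The exponent vector of the leading monomial of a binomial. -/
noncomputable def leadingExponents (i : Fin 15) : Fin 20 →₀ ℕ :=
  Finsupp.single (leadingPair i).1 1 + Finsupp.single (leadingPair i).2 1

/-- The exponent vector of the non-leading monomial of a binomial. -/
noncomputable def tailExponents (i : Fin 15) : Fin 20 →₀ ℕ :=
  ((tailList i).map fun k => Finsupp.single k 1).sum

theorem hiveSum_single (k : Fin 20) : hiveSum (Finsupp.single k 1) = basisHive k := by
  change ∑ l, (Finsupp.single k 1 : Fin 20 →₀ ℕ) l • basisHive l = _
  rw [Finset.sum_eq_single k]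
  · simp
  · intro l _ hl
    rw [Finsupp.single_eq_of_ne hl, zero_smul]
  · simp

theorem hiveSum_leadingExponents (i : Fin 15) :
    hiveSum (leadingExponents i) = hiveSum (tailExponents i) := by
  rw [leadingExponents, tailExponents, map_add, map_list_sum, List.map_map]
  simp only [Function.comp_def, hiveSum_single]
  revert i
  decide

/-- The weights of the variables for which every binomial has the expected leading monomial. -/
def orderWeight : Fin 20 → ℕ :=
  ![0, 1, 0, 0, 0, 2, 2, 0, 1, 2, 1, 0, 0, 0, 3, 2, 3, 2, 2, 3]

/-- This strict drop is what makes the rewriting terminate. -/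
theorem weight_tailExponents_lt (i : Fin 15) :
    Finsupp.weight orderWeight (tailExponents i) < Finsupp.weight orderWeight (leadingExponents i) := by
  rw [leadingExponents, tailExponents, map_add, map_list_sum, List.map_map]
  simp only [Function.comp_def, Finsupp.weight_single, smul_eq_mul, one_mul]
  revert i
  decide

/-- A rewriting step therefore never produces a single variable; the irreducibility of the
generators depends on this. -/
theorem two_le_degree_tailExponents (i : Fin 15) : 2 ≤ (tailExponents i).degree := by
  rw [tailExponents, map_list_sum, List.map_map]
  simp only [Function.comp_def, Finsupp.degree_single]
  revert i
  decide

-- Two signs are needed because the leading term is listed first in some binomials and second in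
-- others.
open MvPolynomial in
theorem hiveRelations_eq (i : Fin 15) :
    hiveRelations i = monomial (leadingExponents i) 1 - monomial (tailExponents i) 1 ∨
      hiveRelations i = monomial (tailExponents i) 1 - monomial (leadingExponents i) 1 := by
  have h1 : (monomial (leadingExponents i) 1 : MvPolynomial (Fin 20) ℂ) =
      X (leadingPair i).1 * X (leadingPair i).2 := by
    simp [leadingExponents, X, monomial_mul]
  have h2 : ∀ l : List (Fin 20), (monomial (l.map fun k => Finsupp.single k 1).sum 1 :
      MvPolynomial (Fin 20) ℂ) = (l.map X).prod := by
    intro l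
    induction l with
    | nil => simp
    | cons a l ih => simp [← ih, X, monomial_mul]
  rw [h1, tailExponents, h2]
  fin_cases i <;> simp [hiveRelations, xVar, leadingPair, tailList, mul_assoc]
  all_goals first | exact Or.inl rfl | exact Or.inr rfl

theorem monomial_leading_sub_tail_mem (i : Fin 15) :
    (MvPolynomial.monomial (leadingExponents i) 1 - MvPolynomial.monomial (tailExponents i) 1 :
      MvPolynomial (Fin 20) ℂ) ∈ hiveIdeal := by
  have hr : hiveRelations i ∈ hiveIdeal := Ideal.subset_span ⟨i, rfl⟩
  rcases hiveRelations_eq i with hi | hi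
  · rwa [← hi]
  · rwa [← neg_mem_iff, neg_sub, ← hi]

open MvPolynomial in
/-- Every monomial is congruent to a standard one modulo the ideal; the reduction leaves monomials
alone whose standard form is a single variable. -/
theorem exists_standard (e : Fin 20 →₀ ℕ) : ∃ s : Fin 20 →₀ ℕ, IsStandard s ∧
    hiveSum s = hiveSum e ∧
    (monomial e 1 - monomial s 1 : MvPolynomial (Fin 20) ℂ) ∈ hiveIdeal ∧
    (s = e ∨ 2 ≤ s.degree) := by
  induction hw : Finsupp.weight orderWeight e using Nat.strong_induction_on generalizing e with
  | _ w ih =>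
    by_cases he : IsStandard e
    · exact ⟨e, he, rfl, by simp, Or.inl rfl⟩
    · simp only [IsStandard, not_forall, not_or] at he
      obtain ⟨i, hi1, hi2⟩ := he
      -- The two leading variables are distinct, so positivity of both exponents already gives
      -- divisibility.
      have hle : leadingExponents i ≤ e := by
        have hne : (leadingPair i).1 ≠ (leadingPair i).2 := leadingPair_ne i
        intro k
        rw [leadingExponents, Finsupp.add_apply, Finsupp.single_apply, Finsupp.single_apply]
        split_ifs with h1 h2 h2
        · exact absurd (h1.trans h2.symm) hne
        · subst h1; omega
        · subst h2; omega
        · omega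
      obtain ⟨r, rfl⟩ := exists_add_of_le hle
      -- Exchange the leading term for the tail, keeping the cofactor r, and recurse on the smaller
      -- weight.
      obtain ⟨s, hs, hsum, hmem, hdeg⟩ := ih _ (by
        rw [← hw, map_add, map_add]
        exact Nat.add_lt_add_right (weight_tailExponents_lt i) _) (tailExponents i + r) rfl
      refine ⟨s, hs, ?_, ?_, Or.inr ?_⟩
      · rw [hsum, map_add, map_add, hiveSum_leadingExponents]
      · have := Ideal.mul_mem_right (monomial r 1) _ (monomial_leading_sub_tail_mem i)
        rw [sub_mul, monomial_mul, monomial_mul, one_mul] at this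
        simpa using add_mem this hmem
      · rcases hdeg with rfl | h
        · rw [map_add]
          exact (two_le_degree_tailExponents i).trans (Nat.le_add_right _ _)
        · exact h

/-- The standard monomial reached by rewriting has the same hive, and `normalForm` recovers a
standard vector from its hive. -/
theorem normalForm_hiveSum_mem (e : Fin 20 →₀ ℕ) :
    (MvPolynomial.monomial e 1 - MvPolynomial.monomial (normalForm (hiveSum e)) 1 :
      MvPolynomial (Fin 20) ℂ) ∈ hiveIdeal := by
  obtain ⟨s, hs, hsum, hmem, -⟩ := exists_standard e
  rwa [← hsum, normalForm_hiveSum hs]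

/-! ### The Hilbert basis -/

theorem isStandard_single (k : Fin 20) : IsStandard (Finsupp.single k 1 : Fin 20 →₀ ℕ) := by
  intro i
  have hne : (leadingPair i).1 ≠ (leadingPair i).2 := leadingPair_ne i
  rw [Finsupp.single_apply, Finsupp.single_apply]
  split_ifs with h1 h2 <;> simp_all

/-- The standard form of e has the hive of x_k, hence is x_k. Its degree 1 rules out that any
rewriting took place, so e was x_k from the start. -/
theorem eq_single_of_hiveSum_eq {e : Fin 20 →₀ ℕ} {k : Fin 20} (h : hiveSum e = basisHive k) :
    e = Finsupp.single k 1 := by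
  obtain ⟨s, hs, hsum, -, hdeg⟩ := exists_standard e
  have hsk : s = Finsupp.single k 1 := by
    rw [← normalForm_hiveSum hs, hsum, h, ← hiveSum_single,
      normalForm_hiveSum (isStandard_single k)]
  rcases hdeg with rfl | h2
  · exact hsk
  · rw [hsk, Finsupp.degree_single] at h2; omega

theorem basisHive_injective : Function.Injective basisHive := by
  intro k l hkl
  have := eq_single_of_hiveSum_eq ((hiveSum_single k).trans hkl)
  exact Finsupp.single_left_injective one_ne_zero this

theorem isHive_hiveSum (e : Fin 20 →₀ ℕ) : IsHive (hiveSum e) := by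
  obtain ⟨e11, e21, e22, e31, e32, e33, e41, e42, e43, e44, e51, e52, e53, e54, e55⟩ :=
    hiveSum_entries e
  rw [isHive_four_iff, e11, e21, e22, e31, e32, e33, e41, e42, e43, e44, e51, e52, e53, e54, e55]
  clear e11 e21 e22 e31 e32 e33 e41 e42 e43 e44 e51 e52 e53 e54 e55
  constructor <;> omega

theorem isHive_basisHive (k : Fin 20) : IsHive (basisHive k) :=
  hiveSum_single k ▸ isHive_hiveSum _

theorem closure_range_basisHive : AddSubmonoid.closure (Set.range basisHive) = hiveCone 4 := by
  apply le_antisymm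
  · rw [AddSubmonoid.closure_le]
    rintro _ ⟨k, rfl⟩
    exact isHive_basisHive k
  · intro h hh
    rw [← hiveSum_normalForm hh]
    change ∑ k, normalForm h k • basisHive k ∈ _
    exact sum_mem fun k _ =>
      nsmul_mem (AddSubmonoid.subset_closure (Set.mem_range_self k)) _

/-- If x + y = h_k, the normal forms of x and y add up to a vector over h_k, which has degree 1; so
one of them is zero. An irreducible element lies in every generating set. -/
theorem isHilbertBasis_basisHive : IsHilbertBasis (hiveCone 4) (Set.range basisHive) := by
  refine ⟨closure_range_basisHive, ?_⟩
  rintro S (hS : AddSubmonoid.closure S = hiveCone 4) _ ⟨k, rfl⟩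
  have key : ∀ x ∈ AddSubmonoid.closure S, x = basisHive k → x ∈ S := by
    intro x hx
    induction hx using AddSubmonoid.closure_induction with
    | mem x hx => exact fun _ => hx
    | zero =>
      intro h0
      have := eq_single_of_hiveSum_eq ((map_zero hiveSum).trans h0)
      exact absurd this.symm (Finsupp.single_ne_zero.2 one_ne_zero)
    | add x y hx hy ihx ihy =>
      intro hxy
      rw [hS] at hx hy
      have hs : hiveSum (normalForm x + normalForm y) = basisHive k := by
        rw [map_add, hiveSum_normalForm hx, hiveSum_normalForm hy, hxy]
      have hdeg := congrArg Finsupp.degree (eq_single_of_hiveSum_eq hs)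
      rw [map_add, Finsupp.degree_single] at hdeg
      rcases Nat.eq_zero_or_pos (normalForm x).degree with h0 | h0
      · have hx0 : x = 0 := by
          rw [← hiveSum_normalForm hx, (Finsupp.degree_eq_zero_iff (normalForm x)).1 h0, map_zero]
        subst hx0
        rw [zero_add] at hxy ⊢
        exact ihy hxy
      · have hy0 : y = 0 := by
          rw [← hiveSum_normalForm hy, (Finsupp.degree_eq_zero_iff (normalForm y)).1 (by omega), map_zero]
        subst hy0
        rw [add_zero] at hxy ⊢
        exact ihx hxy
  exact key _ (hS ▸ isHive_basisHive k) rfl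

/-! ### The presentation of the hive algebra -/

/-- The exponents of `z ^ h`. -/
noncomputable def natExponents {n : ℕ} (h : TriArray n) : TriIndex n →₀ ℕ :=
  Finsupp.equivFunOnFinite.symm fun p => (h p).toNat

theorem zMonomial_eq_monomial {n : ℕ} (h : TriArray n) :
    zMonomial h = MvPolynomial.monomial (natExponents h) 1 := by
  rw [MvPolynomial.monomial_eq, Finsupp.prod_fintype _ _ (by simp)]
  simp [zMonomial, natExponents]

theorem IsHive.natExponents_apply {n : ℕ} {h : TriArray n} (H : IsHive h) (p : TriIndex n) :
    (natExponents h p : ℤ) = h p :=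
  Int.toNat_of_nonneg (H.nonneg p)

theorem IsHive.coe_natExponents {n : ℕ} {h : TriArray n} (H : IsHive h) :
    (fun p => (natExponents h p : ℤ)) = h :=
  funext H.natExponents_apply

theorem zMonomial_add {n : ℕ} {h h' : TriArray n} (H : IsHive h) (H' : IsHive h') :
    zMonomial (h + h') = zMonomial h * zMonomial h' := by
  rw [zMonomial_eq_monomial, zMonomial_eq_monomial, zMonomial_eq_monomial,
    MvPolynomial.monomial_mul, one_mul]
  refine congrArg (MvPolynomial.monomial · 1) (Finsupp.ext fun p => ?_)
  have := (H.add H').natExponents_apply p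
  rw [Pi.add_apply, ← H.natExponents_apply, ← H'.natExponents_apply] at this
  exact_mod_cast this

theorem zMonomial_zero {n : ℕ} : zMonomial (0 : TriArray n) = 1 := by
  simp [zMonomial]

/-- The homomorphism `x_k ↦ z ^ h_k`. -/
noncomputable def hiveHom : MvPolynomial (Fin 20) ℂ →ₐ[ℂ] MvPolynomial (TriIndex 4) ℂ :=
  MvPolynomial.aeval fun k => zMonomial (basisHive k)

theorem hiveHom_monomial (e : Fin 20 →₀ ℕ) :
    hiveHom (MvPolynomial.monomial e 1) = zMonomial (hiveSum e) := by
  induction e using Finsupp.induction_linear with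
  | zero => rw [map_zero, zMonomial_zero]; exact map_one hiveHom
  | add f g hf hg =>
    rw [map_add, zMonomial_add (isHive_hiveSum f) (isHive_hiveSum g), ← hf, ← hg, ← map_mul,
      MvPolynomial.monomial_mul, one_mul]
  | single k m =>
    induction m with
    | zero => rw [Finsupp.single_zero, map_zero, zMonomial_zero]; exact map_one hiveHom
    | succ m ih =>
      rw [Finsupp.single_add, map_add, zMonomial_add (isHive_hiveSum _) (isHive_hiveSum _), ← ih,
        hiveSum_single, ← mul_one (1 : ℂ), ← MvPolynomial.monomial_mul, map_mul, mul_one]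
      congr 1
      exact MvPolynomial.aeval_X _ k

theorem hiveHom_range : hiveHom.range = hiveAlgebra 4 := by
  apply le_antisymm
  · rw [hiveHom, ← Algebra.adjoin_range_eq_range_aeval]
    apply Algebra.adjoin_mono
    rintro _ ⟨k, rfl⟩
    exact ⟨_, isHive_basisHive k, rfl⟩
  · apply Algebra.adjoin_le
    rintro _ ⟨h, hh, rfl⟩
    exact ⟨MvPolynomial.monomial (normalForm h) 1,
      (hiveHom_monomial _).trans (congrArg zMonomial (hiveSum_normalForm hh))⟩

/-- The linear map that sends `z ^ h`, `h` a hive, to the standard monomial of `h`. -/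
noncomputable def standardLift : MvPolynomial (TriIndex 4) ℂ →ₗ[ℂ] MvPolynomial (Fin 20) ℂ :=
  (MvPolynomial.basisMonomials (TriIndex 4) ℂ).constr ℂ fun m =>
    MvPolynomial.monomial (normalForm fun p => (m p : ℤ)) 1

theorem standardLift_zMonomial {h : TriArray 4} (H : IsHive h) :
    standardLift (zMonomial h) = MvPolynomial.monomial (normalForm h) 1 := by
  have := (MvPolynomial.basisMonomials (TriIndex 4) ℂ).constr_basis ℂ (fun m =>
    (MvPolynomial.monomial (normalForm fun p => (m p : ℤ)) 1 : MvPolynomial (Fin 20) ℂ))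
    (natExponents h)
  rw [MvPolynomial.coe_basisMonomials, H.coe_natExponents] at this
  rw [zMonomial_eq_monomial]
  exact this

/-- On monomials, `standardLift` after `hiveHom` is the passage to the standard monomial, which
stays in the same class modulo the ideal. For f in the kernel this says f itself lies in the ideal.
-/
theorem sub_standardLift_mem (f : MvPolynomial (Fin 20) ℂ) :
    f - standardLift (hiveHom f) ∈ hiveIdeal := by
  induction f using MvPolynomial.induction_on' with
  | monomial e a =>
    have h : MvPolynomial.monomial e a = a • (MvPolynomial.monomial e 1 : MvPolynomial (Fin 20) ℂ) := by
      rw [MvPolynomial.smul_monomial, smul_eq_mul, mul_one]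
    rw [h, map_smul, map_smul, ← smul_sub, hiveHom_monomial,
      standardLift_zMonomial (isHive_hiveSum e)]
    exact Submodule.smul_of_tower_mem _ a (normalForm_hiveSum_mem e)
  | add f g hf hg =>
    rw [map_add, map_add, add_sub_add_comm]
    exact add_mem hf hg

theorem ker_hiveHom : RingHom.ker hiveHom = hiveIdeal := by
  apply le_antisymm
  · intro f hf
    have := sub_standardLift_mem f
    rwa [(RingHom.mem_ker).1 hf, map_zero, sub_zero] at this
  · rw [hiveIdeal, Ideal.span_le]
    rintro _ ⟨i, rfl⟩
    rw [SetLike.mem_coe, RingHom.mem_ker]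
    rcases hiveRelations_eq i with hi | hi <;>
      rw [hi, map_sub, hiveHom_monomial, hiveHom_monomial, hiveSum_leadingExponents, sub_self]

/-- The presentation of the hive algebra. -/
theorem exists_hiveAlgebra_equiv :
    ∃ e : (MvPolynomial (Fin 20) ℂ ⧸ hiveIdeal) ≃ₐ[ℂ] hiveAlgebra 4,
      ∀ k : Fin 20, (e (Ideal.Quotient.mk hiveIdeal (MvPolynomial.X k)) :
        MvPolynomial (TriIndex 4) ℂ) = zMonomial (basisHive k) := by
  refine ⟨(Ideal.quotientEquivAlgOfEq ℂ ker_hiveHom.symm).trans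
    ((Ideal.quotientKerEquivRange hiveHom).trans (Subalgebra.equivOfEq _ _ hiveHom_range)), ?_⟩
  intro k
  exact MvPolynomial.aeval_X (fun k => zMonomial (basisHive k)) k

/-! ### Graded components and numbers of hives -/

theorem sum_boundaryA {n : ℕ} {h : TriArray n} (H : IsHive h) :
    ∑ i, h.boundaryA i = h.entry (n + 1) (n + 1) := by
  have := Finset.sum_range_sub (fun k => h.entry (k + 1) (k + 1)) n
  rw [zero_add, H.top_eq_zero, sub_zero] at this
  rw [← this, ← Fin.sum_univ_eq_sum_range (fun k => h.entry (k + 1 + 1) (k + 1 + 1) - h.entry (k + 1) (k + 1))]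
  rfl

/-- The sum over boundary triples collapses: every hive belongs to the triple of its own boundaries,
and ∑ a_i telescopes to the bottom right entry. -/
theorem hiveAlgebraDegree_eq_span (n d : ℕ) : hiveAlgebraDegree n d =
    Submodule.span ℂ {f : hiveAlgebra n | ∃ h, IsHive h ∧ h.entry (n + 1) (n + 1) = d ∧
      (f : MvPolynomial (TriIndex n) ℂ) = zMonomial h} := by
  apply le_antisymm
  · simp only [hiveAlgebraDegree, iSup_le_iff]
    rintro lam μ ν ⟨-, -, -, hd⟩
    apply Submodule.span_mono
    rintro f ⟨h, hh, rfl, -, -, hf⟩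
    exact ⟨h, hh, by rw [← sum_boundaryA hh, hd], hf⟩
  · rw [Submodule.span_le]
    rintro f ⟨h, hh, hd, hf⟩
    refine Submodule.mem_iSup_of_mem h.boundaryA <| Submodule.mem_iSup_of_mem h.boundaryB <|
      Submodule.mem_iSup_of_mem h.boundaryC <| Submodule.mem_iSup_of_mem
        ⟨hh.dominantA, hh.dominantB, hh.dominantC, by rw [sum_boundaryA hh, hd]⟩ <|
      Submodule.subset_span ⟨h, hh, rfl, rfl, rfl, hf⟩

theorem map_hiveAlgebraDegree (n d : ℕ) :
    (hiveAlgebraDegree n d).map (hiveAlgebra n).val.toLinearMap =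
      Submodule.span ℂ (Set.range fun h : {h : TriArray n // IsHive h ∧
        h.entry (n + 1) (n + 1) = d} => zMonomial h.1) := by
  rw [hiveAlgebraDegree_eq_span, Submodule.map_span]
  congr 1
  ext f
  constructor
  · rintro ⟨f, ⟨h, hh, hd, hf⟩, rfl⟩
    exact ⟨⟨h, hh, hd⟩, hf.symm⟩
  · rintro ⟨⟨h, hh, hd⟩, rfl⟩
    exact ⟨⟨zMonomial h, Algebra.subset_adjoin ⟨h, hh, rfl⟩⟩, ⟨h, hh, hd, rfl⟩, rfl⟩

theorem linearIndependent_zMonomial (n d : ℕ) :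
    LinearIndependent ℂ fun h : {h : TriArray n // IsHive h ∧
      h.entry (n + 1) (n + 1) = d} => zMonomial h.1 := by
  have := (MvPolynomial.basisMonomials (TriIndex n) ℂ).linearIndependent.comp
    (fun h : {h : TriArray n // IsHive h ∧ h.entry (n + 1) (n + 1) = d} => natExponents h.1)
    (fun h h' hh => Subtype.ext <| by
      have hh : natExponents h.1 = natExponents h'.1 := hh
      rw [← h.2.1.coe_natExponents, hh, h'.2.1.coe_natExponents])
  have e : (fun h : {h : TriArray n // IsHive h ∧ h.entry (n + 1) (n + 1) = d} => zMonomial h.1) =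
      MvPolynomial.basisMonomials (TriIndex n) ℂ ∘ fun h => natExponents h.1 := by
    funext h
    rw [zMonomial_eq_monomial, Function.comp_apply, MvPolynomial.coe_basisMonomials]
  rw [e]
  exact this

theorem finite_hiveAlgebraDegree (n d : ℕ)
    [Finite {h : TriArray n // IsHive h ∧ h.entry (n + 1) (n + 1) = d}] :
    Module.Finite ℂ (hiveAlgebraDegree n d) := by
  let e := Submodule.equivMapOfInjective (hiveAlgebra n).val.toLinearMap Subtype.val_injective
    (hiveAlgebraDegree n d)
  have : Module.Finite ℂ ((hiveAlgebraDegree n d).map (hiveAlgebra n).val.toLinearMap) := by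
    rw [map_hiveAlgebraDegree]
    exact Module.Finite.span_of_finite ℂ (Set.finite_range _)
  exact Module.Finite.equiv e.symm

theorem finrank_hiveAlgebraDegree (n d : ℕ)
    [Finite {h : TriArray n // IsHive h ∧ h.entry (n + 1) (n + 1) = d}] :
    Module.finrank ℂ (hiveAlgebraDegree n d) =
      Nat.card {h : TriArray n // IsHive h ∧ h.entry (n + 1) (n + 1) = d} := by
  have := Fintype.ofFinite {h : TriArray n // IsHive h ∧ h.entry (n + 1) (n + 1) = d}
  rw [(Submodule.equivMapOfInjective (hiveAlgebra n).val.toLinearMap Subtype.val_injective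
    (hiveAlgebraDegree n d)).finrank_eq, map_hiveAlgebraDegree,
    finrank_span_eq_card (linearIndependent_zMonomial n d), Nat.card_eq_fintype_card]

/-! ### Hives of degree d as standard monomials -/

/-- The bottom right entries of the twenty hives, i.e. their degrees. -/
def hiveDegree : Fin 20 → ℕ :=
  ![1, 2, 3, 4, 1, 2, 3, 4, 2, 3, 4, 3, 4, 4, 4, 5, 6, 5, 6, 6]

theorem hiveDegree_pos : ∀ k, 0 < hiveDegree k := by
  decide

theorem hiveSum_entry_five_five (e : Fin 20 →₀ ℕ) :
    (hiveSum e).entry 5 5 = ((∑ k, hiveDegree k * e k : ℕ) : ℤ) := by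
  have h : ∀ k, (basisHive k).entry 5 5 = hiveDegree k := by decide
  rw [hiveSum_entry]
  push_cast
  exact Finset.sum_congr rfl fun k _ => by rw [h, mul_comm]

/-- The exponent vectors of the standard monomials of degree `d`, with the `k`-th entry scaled by
the degree of the `k`-th variable. -/
def scaledStandard (d : ℕ) : Finset (Fin 20 →₀ ℕ) :=
  {l ∈ Finset.univ.finsuppAntidiag d | (∀ k, hiveDegree k ∣ l k) ∧
    ∀ i, l (leadingPair i).1 = 0 ∨ l (leadingPair i).2 = 0}

theorem mem_scaledStandard {d : ℕ} {l : Fin 20 →₀ ℕ} : l ∈ scaledStandard d ↔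
    ∑ k, l k = d ∧ (∀ k, hiveDegree k ∣ l k) ∧
      ∀ i, l (leadingPair i).1 = 0 ∨ l (leadingPair i).2 = 0 := by
  rw [scaledStandard, Finset.mem_filter, Finset.mem_finsuppAntidiag]
  exact and_congr_left fun _ => and_iff_left (Finset.subset_univ _)

/-- Hives of degree `d` correspond to standard monomials of degree `d`. -/
noncomputable def hivesEquivScaledStandard (d : ℕ) :
    {h : TriArray 4 // IsHive h ∧ h.entry (4 + 1) (4 + 1) = d} ≃ scaledStandard d where
  toFun h := ⟨Finsupp.equivFunOnFinite.symm fun k => hiveDegree k * normalForm h.1 k, by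
    have hs : IsStandard (normalForm h.1) := by
      obtain ⟨s, hs, hsum, -⟩ := exists_standard (normalForm h.1)
      rw [hiveSum_normalForm h.2.1] at hsum
      rw [← hsum, normalForm_hiveSum hs]
      exact hs
    have hd := hiveSum_entry_five_five (normalForm h.1)
    rw [hiveSum_normalForm h.2.1] at hd
    refine mem_scaledStandard.2 ⟨?_, fun k => Dvd.intro _ rfl, fun i => ?_⟩
    · exact_mod_cast hd.symm.trans h.2.2
    · exact (hs i).imp (fun h => by simp [h]) (fun h => by simp [h])⟩
  invFun l := ⟨hiveSum (Finsupp.equivFunOnFinite.symm fun k => l.1 k / hiveDegree k), by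
    have hl := mem_scaledStandard.1 l.2
    refine ⟨isHive_hiveSum _, (hiveSum_entry_five_five _).trans ?_⟩
    refine congrArg _ (Eq.trans ?_ hl.1)
    exact Finset.sum_congr rfl fun k _ => Nat.mul_div_cancel' (hl.2.1 k)⟩
  left_inv h := by
    apply Subtype.ext
    refine (congrArg hiveSum ?_).trans (hiveSum_normalForm h.2.1)
    ext k
    exact Nat.mul_div_cancel_left _ (hiveDegree_pos k)
  right_inv l := by
    have hl := mem_scaledStandard.1 l.2
    apply Subtype.ext
    have hs : IsStandard (Finsupp.equivFunOnFinite.symm fun k => l.1 k / hiveDegree k :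
        Fin 20 →₀ ℕ) := fun i =>
      (hl.2.2 i).imp (fun h => by simp [h]) (fun h => by simp [h])
    ext k
    change hiveDegree k * normalForm (hiveSum _) k = _
    rw [normalForm_hiveSum hs]
    exact Nat.mul_div_cancel' (hl.2.1 k)

theorem finite_hives_four (d : ℕ) :
    Finite {h : TriArray 4 // IsHive h ∧ h.entry (4 + 1) (4 + 1) = d} :=
  Finite.of_equiv _ (hivesEquivScaledStandard d).symm

theorem coeff_hiveSeries_four (d : ℕ) :
    PowerSeries.coeff d (hiveSeries 4) = ((scaledStandard d).card : ℤ) := by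
  have := finite_hives_four d
  rw [hiveSeries, PowerSeries.coeff_mk, finrank_hiveAlgebraDegree,
    Nat.card_congr (hivesEquivScaledStandard d), Nat.card_eq_fintype_card, Fintype.card_coe]

/-! ### The generating function of the standard monomials -/

/-- A partition of the set of standard exponent vectors into fourteen pieces: in each piece the
exponents in `pieceZero` vanish, those in `piecePos` do not, and the others are arbitrary. -/
def pieceZero : Fin 14 → Finset (Fin 20) :=
  ![{14, 15, 16, 17, 18, 19}, {9, 14, 15, 16, 17, 18}, {6, 14, 15, 17, 18, 19},
    {6, 9, 14, 15, 17, 19}, {6, 9, 14, 15, 16, 17}, {5, 15, 16, 17, 18, 19},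
    {5, 9, 15, 16, 18, 19}, {5, 9, 14, 15, 16, 18}, {5, 6, 16, 17, 18, 19},
    {5, 6, 14, 17, 18, 19}, {5, 6, 9, 16, 18, 19}, {5, 6, 9, 14, 17, 19},
    {5, 6, 9, 14, 16, 19}, {5, 6, 9, 14, 15, 16}]

/-- See `pieceZero`. -/
def piecePos : Fin 14 → Finset (Fin 20) :=
  ![∅, {19}, {16}, {18}, {18, 19}, {14}, {17}, {17, 19}, {15}, {15, 16}, {15, 17}, {15, 18},
    {17, 18}, {17, 18, 19}]

/-- Only nine variables occur in leading pairs. The supports among them that contain no leading pair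
form a simplicial complex with fourteen triangles; each piece consists of the faces between
`piecePos i` and the triangle left over by `pieceZero i`. -/
theorem standard_iff_exists_piece (l : Fin 20 → ℕ) :
    (∀ i, l (leadingPair i).1 = 0 ∨ l (leadingPair i).2 = 0) ↔
      ∃ i, ∀ k, (k ∈ pieceZero i → l k = 0) ∧ (k ∈ piecePos i → l k ≠ 0) := by
  constructor
  · intro h
    have h := (isStandard_iff l).1 h
    -- Only the vanishing pattern matters, so a check of 2⁹ Boolean cases is enough.
    have key : ∀ z5 z6 z9 z14 z15 z16 z17 z18 z19 : Bool,
        ((z5 || z14) && (z5 || z15) && (z9 || z17) && (z9 || z19) && (z6 || z16) && (z6 || z18) &&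
          (z5 || z17) && (z6 || z15) && (z9 || z18) && (z14 || z16) && (z14 || z18) &&
          (z14 || z19) && (z15 || z19) && (z16 || z19) && (z16 || z17)) = true →
        ∃ i : Fin 14, ∀ q ∈ [((5 : Fin 20), z5), (6, z6), (9, z9), (14, z14), (15, z15), (16, z16),
          (17, z17), (18, z18), (19, z19)],
          (q.1 ∈ pieceZero i → q.2 = true) ∧ (q.1 ∈ piecePos i → q.2 = false) := by
      decide
    obtain ⟨i, hi⟩ := key (l 5 = 0) (l 6 = 0) (l 9 = 0) (l 14 = 0) (l 15 = 0) (l 16 = 0)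
      (l 17 = 0) (l 18 = 0) (l 19 = 0) (by simpa [and_assoc] using h)
    have hk : ∀ k, k ∈ [(5 : Fin 20), 6, 9, 14, 15, 16, 17, 18, 19] →
        (k ∈ pieceZero i → l k = 0) ∧ (k ∈ piecePos i → l k ≠ 0) := by
      intro k hk
      have := hi (k, decide (l k = 0)) (by
        simp only [List.mem_cons, List.not_mem_nil, or_false] at hk ⊢
        rcases hk with rfl | rfl | rfl | rfl | rfl | rfl | rfl | rfl | rfl <;> simp)
      simpa using this
    have hsub : ∀ i k, k ∈ pieceZero i ∨ k ∈ piecePos i →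
        k ∈ [(5 : Fin 20), 6, 9, 14, 15, 16, 17, 18, 19] := by
      decide
    exact ⟨i, fun k => ⟨fun h => (hk k (hsub i k (Or.inl h))).1 h,
      fun h => (hk k (hsub i k (Or.inr h))).2 h⟩⟩
  · rintro ⟨i, hi⟩ j
    have key : ∀ i j, (leadingPair j).1 ∈ pieceZero i ∨ (leadingPair j).2 ∈ pieceZero i := by
      decide
    exact (key i j).imp (hi _).1 (hi _).1

theorem piece_disjoint {i j : Fin 14} {l : Fin 20 → ℕ}
    (hi : ∀ k, (k ∈ pieceZero i → l k = 0) ∧ (k ∈ piecePos i → l k ≠ 0))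
    (hj : ∀ k, (k ∈ pieceZero j → l k = 0) ∧ (k ∈ piecePos j → l k ≠ 0)) : i = j := by
  by_contra hij
  have key : ∀ i j, i ≠ j → ∃ k, k ∈ pieceZero i ∧ k ∈ piecePos j ∨
      k ∈ piecePos i ∧ k ∈ pieceZero j := by
    decide
  obtain ⟨k, ⟨h1, h2⟩ | ⟨h1, h2⟩⟩ := key i j hij
  · exact (hj k).2 h2 ((hi k).1 h1)
  · exact (hi k).2 h1 ((hj k).1 h2)

theorem pieceZero_disjoint : ∀ i k, k ∈ pieceZero i → k ∉ piecePos i := by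
  decide

/-- The generating function of the possible values of `l k`, scaled as in `scaledStandard`, in the
`i`-th piece. -/
noncomputable def pieceFactor (i : Fin 14) (k : Fin 20) : PowerSeries ℤ :=
  PowerSeries.mk fun m =>
    if hiveDegree k ∣ m ∧ (k ∈ pieceZero i → m = 0) ∧ (k ∈ piecePos i → m ≠ 0) then 1 else 0

/-- Scaling exponents by degrees turns the count into a sum over the same antidiagonal that computes
a coefficient of a product. Each standard vector is counted once since the pieces are disjoint. -/
theorem hiveSeries_four_eq_sum : hiveSeries 4 = ∑ i, ∏ k, pieceFactor i k := by
  ext d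
  rw [coeff_hiveSeries_four, map_sum, scaledStandard, Finset.card_filter]
  simp only [PowerSeries.coeff_prod, pieceFactor, PowerSeries.coeff_mk]
  rw [Finset.sum_comm]
  push_cast
  refine Finset.sum_congr rfl fun l _ => ?_
  simp only [Finset.prod_ite_zero, Finset.prod_const_one, Finset.mem_univ, true_imp_iff]
  simp only [standard_iff_exists_piece]
  split_ifs with h
  · obtain ⟨hdvd, i, hi⟩ := h
    rw [Finset.sum_eq_single i]
    · rw [if_pos fun k => ⟨hdvd k, hi k⟩]
    · intro j _ hji
      exact if_neg fun hj => hji (piece_disjoint (fun k => (hj k).2) hi)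
    · simp
  · exact (Finset.sum_eq_zero fun i _ => if_neg fun hi =>
      h ⟨fun k => (hi k).1, i, fun k => (hi k).2⟩).symm

theorem mk_dvd_mul_one_sub_X_pow {c : ℕ} (hc : 0 < c) :
    (PowerSeries.mk fun m => if c ∣ m then (1 : ℤ) else 0) * (1 - PowerSeries.X ^ c) = 1 := by
  ext m
  rw [mul_sub, mul_one, map_sub, PowerSeries.coeff_mul_X_pow', PowerSeries.coeff_one]
  simp only [PowerSeries.coeff_mk]
  rcases Nat.lt_or_ge m c with h | h
  · have : c ∣ m ↔ m = 0 := ⟨fun hd => Nat.eq_zero_of_dvd_of_lt hd h, by rintro rfl; simp⟩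
    simp [this, Nat.not_le.2 h]
  · have : c ∣ m - c ↔ c ∣ m := (Nat.dvd_sub_iff_left h dvd_rfl)
    simp [this, h, show m ≠ 0 by omega]

/-- With c the degree, the factor is 1, t^c/(1 - t^c) or 1/(1 - t^c), according as the exponent is
zero, positive or free. -/
theorem pieceFactor_mul (i : Fin 14) (k : Fin 20) :
    pieceFactor i k * (1 - PowerSeries.X ^ hiveDegree k) =
      if k ∈ pieceZero i then 1 - PowerSeries.X ^ hiveDegree k else
        if k ∈ piecePos i then PowerSeries.X ^ hiveDegree k else 1 := by
  have hone := mk_dvd_mul_one_sub_X_pow (hiveDegree_pos k)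
  split_ifs with h0 h1
  · have h1 : k ∉ piecePos i := pieceZero_disjoint i k h0
    have : pieceFactor i k = 1 := by
      ext m
      rw [pieceFactor, PowerSeries.coeff_mk, PowerSeries.coeff_one]
      refine if_congr ⟨fun h => h.2.1 h0, ?_⟩ rfl rfl
      rintro rfl
      exact ⟨dvd_zero _, fun _ => rfl, fun h => absurd h h1⟩
    rw [this, one_mul]
  · have : pieceFactor i k =
        (PowerSeries.mk fun m => if hiveDegree k ∣ m then (1 : ℤ) else 0) - 1 := by
      ext m
      rw [pieceFactor, map_sub, PowerSeries.coeff_mk, PowerSeries.coeff_mk, PowerSeries.coeff_one]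
      rcases eq_or_ne m 0 with rfl | hm
      · simp [h1]
      · simp [h0, h1, hm]
    rw [this, sub_mul, hone]
    ring
  · have : pieceFactor i k = PowerSeries.mk fun m => if hiveDegree k ∣ m then (1 : ℤ) else 0 := by
      simp [pieceFactor, h0, h1]
    rw [this, hone]

theorem prod_ite_ite {ι R : Type*} [Fintype ι] [DecidableEq ι] [CommMonoid R] {s t : Finset ι}
    (hst : ∀ k ∈ s, k ∉ t) (f g : ι → R) :
    (∏ k, if k ∈ s then f k else if k ∈ t then g k else 1) = (∏ k ∈ s, f k) * ∏ k ∈ t, g k := by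
  have h : ∀ k, (if k ∈ s then f k else if k ∈ t then g k else 1) =
      (if k ∈ s then f k else 1) * if k ∈ t then g k else 1 := by
    intro k
    by_cases hk : k ∈ s
    · simp [hk, hst k hk]
    · simp [hk]
  simp_rw [h, Finset.prod_mul_distrib, Finset.prod_ite_mem, Finset.univ_inter]

/-- This is the equality of the sum of the fourteen rational functions with f/g after clearing
denominators. -/
theorem sum_pieces_mul {R : Type*} [CommRing R] (x : R) :
    (∑ i, (∏ k ∈ pieceZero i, (1 - x ^ hiveDegree k)) * ∏ k ∈ piecePos i, x ^ hiveDegree k) *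
      ((1 - x) ^ 4 * (1 - x ^ 2) ^ 6 * (1 - x ^ 12) ^ 4) =
    (1 - 2 * x - 2 * x ^ 2 + 10 * x ^ 3 - 2 * x ^ 4 - 24 * x ^ 5 + 22 * x ^ 6 + 32 * x ^ 7
      - 54 * x ^ 8 - 18 * x ^ 9 + 80 * x ^ 10 - 14 * x ^ 11 - 72 * x ^ 12 + 34 * x ^ 13 + 44
      * x ^ 14 - 18 * x ^ 15 - 25 * x ^ 16 - 18 * x ^ 17 + 44 * x ^ 18 + 34 * x ^ 19 - 72 *
      x ^ 20 - 14 * x ^ 21 + 80 * x ^ 22 - 18 * x ^ 23 - 54 * x ^ 24 + 32 * x ^ 25 + 22 * x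
      ^ 26 - 24 * x ^ 27 - 2 * x ^ 28 + 10 * x ^ 29 - 2 * x ^ 30 - 2 * x ^ 31 + x ^ 32) *
      ∏ k, (1 - x ^ hiveDegree k) := by
  simp only [Fin.prod_univ_succ, hiveDegree]
  simp [Fin.sum_univ_succ, pieceZero, piecePos]
  ring

open PowerSeries in
theorem coe_hiveNumerator : (hiveNumerator : PowerSeries ℤ) =
    1 - 2 * X - 2 * X ^ 2 + 10 * X ^ 3 - 2 * X ^ 4 - 24 * X ^ 5 + 22 * X ^ 6 + 32 * X ^ 7 - 54
    * X ^ 8 - 18 * X ^ 9 + 80 * X ^ 10 - 14 * X ^ 11 - 72 * X ^ 12 + 34 * X ^ 13 + 44 * X ^ 14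
    - 18 * X ^ 15 - 25 * X ^ 16 - 18 * X ^ 17 + 44 * X ^ 18 + 34 * X ^ 19 - 72 * X ^ 20 - 14 *
    X ^ 21 + 80 * X ^ 22 - 18 * X ^ 23 - 54 * X ^ 24 + 32 * X ^ 25 + 22 * X ^ 26 - 24 * X ^ 27
    - 2 * X ^ 28 + 10 * X ^ 29 - 2 * X ^ 30 - 2 * X ^ 31 + X ^ 32 := by
  have hX : Polynomial.coeToPowerSeries.ringHom (Polynomial.X : Polynomial ℤ) = X := Polynomial.coe_X
  change Polynomial.coeToPowerSeries.ringHom hiveNumerator = _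
  simp only [hiveNumerator, map_add, map_sub, map_mul, map_pow, map_ofNat, map_one, hX]

theorem coe_hiveDenominator : (hiveDenominator : PowerSeries ℤ) =
    (1 - PowerSeries.X) ^ 4 * (1 - PowerSeries.X ^ 2) ^ 6 * (1 - PowerSeries.X ^ 12) ^ 4 := by
  simp [hiveDenominator]

theorem hiveSeries_four_mul_denominator :
    hiveSeries 4 * (hiveDenominator : PowerSeries ℤ) = (hiveNumerator : PowerSeries ℤ) := by
  have h0 : ∏ k, (1 - PowerSeries.X ^ hiveDegree k : PowerSeries ℤ) ≠ 0 :=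
    Finset.prod_ne_zero_iff.2 fun k _ =>
      right_ne_zero_of_mul_eq_one (mk_dvd_mul_one_sub_X_pow (hiveDegree_pos k))
  have h1 : hiveSeries 4 * ∏ k, (1 - PowerSeries.X ^ hiveDegree k) =
      ∑ i, (∏ k ∈ pieceZero i, (1 - PowerSeries.X ^ hiveDegree k)) *
        ∏ k ∈ piecePos i, PowerSeries.X ^ hiveDegree k := by
    rw [hiveSeries_four_eq_sum, Finset.sum_mul]
    refine Finset.sum_congr rfl fun i _ => ?_
    rw [← Finset.prod_mul_distrib, ← prod_ite_ite (pieceZero_disjoint i)]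
    exact Finset.prod_congr rfl fun k _ => pieceFactor_mul i k
  -- Power series over ℤ form a domain, so the common denominator of the pieces cancels.
  apply mul_right_cancel₀ h0
  rw [mul_right_comm, h1, coe_hiveDenominator, coe_hiveNumerator, sum_pieces_mul]

theorem constantCoeff_hiveDenominator :
    PowerSeries.constantCoeff (hiveDenominator : PowerSeries ℤ) = 1 := by
  simp [coe_hiveDenominator]

/-! ### Palindromic numerator and first coefficients -/

/-- The coefficients of the numerator. -/
def numeratorCoeffs : List ℤ :=
  [1, -2, -2, 10, -2, -24, 22, 32, -54, -18, 80, -14, -72, 34, 44, -18, -25,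
    -18, 44, 34, -72, -14, 80, -18, -54, 32, 22, -24, -2, 10, -2, -2, 1]

theorem coeff_hiveNumerator (n : ℕ) : hiveNumerator.coeff n = numeratorCoeffs.getD n 0 := by
  have h : hiveNumerator = ∑ k ∈ Finset.range 33,
      Polynomial.C (numeratorCoeffs.getD k 0) * Polynomial.X ^ k := by
    simp [hiveNumerator, Finset.sum_range_succ, numeratorCoeffs]
    ring
  rw [h, Polynomial.finsetSum_coeff]
  simp only [Polynomial.coeff_C_mul_X_pow, Finset.sum_ite_eq, Finset.mem_range]
  split_ifs with hn
  · rfl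
  -- Past index 32, `getD` returns its default 0.
  · exact (List.getD_eq_default _ _ (not_lt.1 hn)).symm

theorem natDegree_hiveNumerator : hiveNumerator.natDegree = 32 := by
  unfold hiveNumerator
  compute_degree!

theorem reverse_hiveNumerator : hiveNumerator.reverse = hiveNumerator := by
  ext n
  rw [Polynomial.coeff_reverse, natDegree_hiveNumerator, coeff_hiveNumerator, coeff_hiveNumerator]
  rcases le_or_gt n 32 with hn | hn
  · rw [Polynomial.revAt_le hn]
    have key : ∀ m : Fin 33, numeratorCoeffs.getD (32 - m) 0 = numeratorCoeffs.getD m 0 := by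
      decide
    exact key ⟨n, by omega⟩
  · rw [Polynomial.revAt_eq_self_of_lt hn]

theorem exists_truncation_mul_eq {R : Type*} [CommRing R] (x : R) : ∃ r : R,
    (1 + 2 * x + 6 * x ^ 2 + 14 * x ^ 3 + 34 * x ^ 4 + 68 * x ^ 5 + 142 * x ^ 6 + 268 * x ^ 7
     + 508 * x ^ 8 + 902 * x ^ 9) * ((1 - x) ^ 4 * (1 - x ^ 2) ^ 6 * (1 - x ^ 12) ^ 4) =
    (1 - 2 * x - 2 * x ^ 2 + 10 * x ^ 3 - 2 * x ^ 4 - 24 * x ^ 5 + 22 * x ^ 6 + 32 * x ^ 7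
      - 54 * x ^ 8 - 18 * x ^ 9 + 80 * x ^ 10 - 14 * x ^ 11 - 72 * x ^ 12 + 34 * x ^ 13 + 44
      * x ^ 14 - 18 * x ^ 15 - 25 * x ^ 16 - 18 * x ^ 17 + 44 * x ^ 18 + 34 * x ^ 19 - 72 *
      x ^ 20 - 14 * x ^ 21 + 80 * x ^ 22 - 18 * x ^ 23 - 54 * x ^ 24 + 32 * x ^ 25 + 22 * x
      ^ 26 - 24 * x ^ 27 - 2 * x ^ 28 + 10 * x ^ 29 - 2 * x ^ 30 - 2 * x ^ 31 + x ^ 32) + x ^ 10 * r := by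
  -- The witness is the quotient by x^10 of (truncated series)·g - f.
  refine ⟨-1596 + 3686 * x + 6260 * x ^ 2 - 21142 * x ^ 3 - 4464 * x ^ 4 + 49550 * x ^ 5 - 16054 * x
    ^ 6 - 59568 * x ^ 7 + 39242 * x ^ 8 + 36636 * x ^ 9 - 37222 * x ^ 10 - 8294 * x ^ 11 +
    23094 * x ^ 12 - 16434 * x ^ 13 - 27808 * x ^ 14 + 85322 * x ^ 15 + 17678 * x ^ 16 -
    198204 * x ^ 17 + 64338 * x ^ 18 + 238574 * x ^ 19 - 157362 * x ^ 20 - 146998 * x ^ 21 +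
    149715 * x ^ 22 + 33412 * x ^ 23 - 77536 * x ^ 24 + 29088 * x ^ 25 + 49548 * x ^ 26 -
    130296 * x ^ 27 - 26560 * x ^ 28 + 297392 * x ^ 29 - 96514 * x ^ 30 - 357996 * x ^ 31 +
    236156 * x ^ 32 + 220660 * x ^ 33 - 224844 * x ^ 34 - 50208 * x ^ 35 + 108724 * x ^ 36 -
    25272 * x ^ 37 - 43367 * x ^ 38 + 89874 * x ^ 39 + 17710 * x ^ 40 - 198278 * x ^ 41 +
    64346 * x ^ 42 + 238704 * x ^ 43 - 157474 * x ^ 44 - 147160 * x ^ 45 + 149986 * x ^ 46 +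
    33502 * x ^ 47 - 69956 * x ^ 48 + 10728 * x ^ 49 + 18592 * x ^ 50 - 24724 * x ^ 51 - 4428
    * x ^ 52 + 49572 * x ^ 53 - 16087 * x ^ 54 - 59682 * x ^ 55 + 39374 * x ^ 56 + 36798 * x ^
    57 - 37510 * x ^ 58 - 8380 * x ^ 59 + 17110 * x ^ 60 - 1764 * x ^ 61 - 3100 * x ^ 62 + 902
    * x ^ 63, ?_⟩
  ring

/-- Both the truncation and the series give f modulo t^10 when multiplied by g. Since g is a unit,
they agree modulo t^10. -/
theorem coeff_hiveSeries_four_of_lt (d : Fin 10) : PowerSeries.coeff (d : ℕ) (hiveSeries 4) =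
    (![1, 2, 6, 14, 34, 68, 142, 268, 508, 902] : Fin 10 → ℤ) d := by
  obtain ⟨r, hr⟩ := exists_truncation_mul_eq (PowerSeries.X : PowerSeries ℤ)
  have hsum : ∑ k : Fin 10, PowerSeries.C
      ((![1, 2, 6, 14, 34, 68, 142, 268, 508, 902] : Fin 10 → ℤ) k) * PowerSeries.X ^ (k : ℕ) =
      1 + 2 * PowerSeries.X + 6 * PowerSeries.X ^ 2 + 14 * PowerSeries.X ^ 3 + 34 * PowerSeries.X ^ 4 + 68 * PowerSeries.X ^ 5 + 142 * PowerSeries.X ^ 6 + 268 * PowerSeries.X ^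
      7 + 508 * PowerSeries.X ^ 8 + 902 * PowerSeries.X ^ 9 := by
    simp [Fin.sum_univ_succ]
    ring
  rw [← hsum, ← coe_hiveDenominator] at hr
  have hdvd : PowerSeries.X ^ 10 ∣ (∑ k : Fin 10, PowerSeries.C
      ((![1, 2, 6, 14, 34, 68, 142, 268, 508, 902] : Fin 10 → ℤ) k) * PowerSeries.X ^ (k : ℕ) -
        hiveSeries 4) * (hiveDenominator : PowerSeries ℤ) := by
    refine ⟨r, ?_⟩
    rw [sub_mul, hr, hiveSeries_four_mul_denominator, coe_hiveNumerator, add_sub_cancel_left]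
  have hunit : IsUnit (hiveDenominator : PowerSeries ℤ) := by
    rw [PowerSeries.isUnit_iff_constantCoeff, constantCoeff_hiveDenominator]
    exact isUnit_one
  rw [hunit.dvd_mul_right, PowerSeries.X_pow_dvd_iff] at hdvd
  have := hdvd d d.2
  rw [map_sub, sub_eq_zero] at this
  rw [← this, map_sum]
  simp only [PowerSeries.coeff_C_mul, PowerSeries.coeff_X_pow, Fin.val_inj]
  simp

theorem theorem2p6 :
    (Function.Injective basisHive ∧ IsHilbertBasis (hiveCone 4) (Set.range basisHive)) ∧
    (∃ e : (MvPolynomial (Fin 20) ℂ ⧸ hiveIdeal) ≃ₐ[ℂ] hiveAlgebra 4,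
      ∀ k : Fin 20, (e (Ideal.Quotient.mk hiveIdeal (MvPolynomial.X k)) :
        MvPolynomial (TriIndex 4) ℂ) = zMonomial (basisHive k)) ∧
    (∀ d : ℕ, Module.Finite ℂ (hiveAlgebraDegree 4 d)) ∧
    hiveSeries 4 * (hiveDenominator : PowerSeries ℤ) = (hiveNumerator : PowerSeries ℤ) ∧
    PowerSeries.constantCoeff (hiveDenominator : PowerSeries ℤ) = 1 ∧
    hiveNumerator.natDegree = 32 ∧ hiveNumerator.reverse = hiveNumerator ∧
    (∀ d : Fin 10, PowerSeries.coeff (d : ℕ) (hiveSeries 4) =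
      (![1, 2, 6, 14, 34, 68, 142, 268, 508, 902] : Fin 10 → ℤ) d) :=
  ⟨⟨basisHive_injective, isHilbertBasis_basisHive⟩, exists_hiveAlgebra_equiv,
    fun d => have := finite_hives_four d; finite_hiveAlgebraDegree 4 d,
    hiveSeries_four_mul_denominator, constantCoeff_hiveDenominator, natDegree_hiveNumerator,
    reverse_hiveNumerator, coeff_hiveSeries_four_of_lt⟩
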